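/- Let $q,a,k,z\in\mathbb C$ with $|q|<1$ and $a,k,z\neq 0$. Write $(x;q)_n=\prod_{i=0}^{n-1}(1-xq^i)$, $(x;q)_\infty=\prod_{i\ge 0}(1-xq^i)$ and $(x_1,\dots,x_j;q)_n=\prod_{i=1}^{j}(x_i;q)_n$ for $n\in\{0,1,2,\dots\}\cup\{\infty\}$. A pair of sequences $(\alpha_n(a,k),\beta_n(a,k))_{n\ge 0}$ is a WP-Bailey pair (for the parameters $a,k$ and the base $q$) if $\alpha_0(a,k)=\beta_0(a,k)=1$ and, for all $n>0$, $$\beta_n(a,k)=\sum_{j=0}^{n}\frac{(k/a;q)_{n-j}(k;q)_{n+j}}{(q;q)_{n-j}(aq;q)_{n+j}}\,\alpha_j(a,k).$$ Suppose that $(\alpha_n(a,k),\beta_n(a,k))$ is a WP-Bailey pair for the parameters $a,k$, and that $(\alpha_n(1/a,1/k),\beta_n(1/a,1/k))$ is one for the parameters $1/a,1/k$. Assume that no denominator below vanishes, i.e. none of $a$, $k$, $z/a$, $z/k$ is an integer power of $q$ (for $q=0$ the only power meant, besides $0$, is $q^0=1$), that $|qa|<|z|$ and $|qz|<|a|$ (that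 is, $|qa|<|z|<|a/q|$), and that the two series below that contain $\alpha_n(a,k)$ and $\alpha_n(1/a,1/k)$ converge. Then the two series that contain $\beta_n(a,k)$ and $\beta_n(1/a,1/k)$ converge as well, and, for any choice of the square roots $\sqrt{k}$ and $\sqrt{1/k}$, $$\begin{aligned} &\sum_{n=1}^{\infty}\frac{(q\sqrt k,-q\sqrt k,z;q)_n(q;q)_{n-1}}{\left(\sqrt k,-\sqrt k,qk,\frac{qk}{z};q\right)_n}\left(\frac{qa}{z}\right)^n\beta_n(a,k)\\ &-\sum_{n=1}^{\infty}\frac{\left(q\sqrt{\frac1k},-q\sqrt{\frac1k},\frac1z;q\right)_n(q;q)_{n-1}}{\left(\sqrt{\frac1k},-\sqrt{\frac1k},\frac qk,\frac{qz}{k};q\right)_n}\left(\frac{qz}{a}\right)^n\beta_n\!\left(\frac1a,\frac1k\right)\\ &-\sum_{n=1}^{\infty}\frac{(z;q)_n(q;q)_{n-1}}{\left(qa,\frac{qa}{z};q\right)_n}\left(\frac{qa}{z}\right)^n\alpha_n(a,k) +\sum_{n=1}^{\infty}\frac{\left(\frac1z;q\right)_n(q;q)_{n-1}}{\left(\frac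 qa,\frac{qz}{a};q\right)_n}\left(\frac{qz}{a}\right)^n\alpha_n\!\left(\frac1a,\frac1k\right)\\ &=\frac{(a-k)\left(1-\frac1z\right)\left(1-\frac{ak}{z}\right)}{(1-a)(1-k)\left(1-\frac az\right)\left(1-\frac kz\right)} +\frac zk\,\frac{\left(z,\frac qz,\frac ka,\frac{qa}{k},\frac{ak}{z},\frac{qz}{ak},q,q;q\right)_\infty}{\left(\frac zk,\frac{qk}{z},\frac za,\frac{qa}{z},a,\frac qa,k,\frac qk;q\right)_\infty}. \end{aligned}$$ -/

import Mathlib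

noncomputable section

namespace WPBailey

/-- The finite `q`-shifted factorial `(x;q)_n = (1-x)(1-xq)⋯(1-xq^{n-1})`. -/
def qPoch (x q : ℂ) (n : ℕ) : ℂ := ∏ i ∈ Finset.range n, (1 - x * q ^ i)

/-- `(x₁, …, x_j; q)_n = (x₁;q)_n ⋯ (x_j;q)_n`. -/
def qPochs (xs : List ℂ) (q : ℂ) (n : ℕ) : ℂ := (xs.map fun x => qPoch x q n).prod

/-- The infinite product `(x;q)_∞ = ∏_{i ≥ 0} (1 - x q^i)`, absolutely convergent for `|q| < 1`. -/
def qPochInf (x q : ℂ) : ℂ := ∏' i : ℕ, (1 - x * q ^ i)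

/-- `(x₁, …, x_j; q)_∞ = (x₁;q)_∞ ⋯ (x_j;q)_∞`. -/
def qPochsInf (xs : List ℂ) (q : ℂ) : ℂ := (xs.map fun x => qPochInf x q).prod

/-- `(α_n, β_n)` is a WP-Bailey pair for the parameters `a`, `k` and base `q`. -/
structure IsWPBaileyPair (q a k : ℂ) (α β : ℕ → ℂ) : Prop where
  alpha_zero : α 0 = 1
  beta_zero : β 0 = 1
  beta_eq : ∀ n : ℕ, 0 < n →
    β n = ∑ j ∈ Finset.range (n + 1),
      (qPoch (k / a) q (n - j) * qPoch k q (n + j)) /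
        (qPoch q q (n - j) * qPoch (a * q) q (n + j)) * α j

/-- The series `∑_{n ≥ 1} u n` converges (as a limit of partial sums) and has sum `S`. -/
def SeriesHasSum (u : ℕ → ℂ) (S : ℂ) : Prop :=
  Filter.Tendsto (fun N : ℕ => ∑ n ∈ Finset.Icc 1 N, u n) Filter.atTop (nhds S)

end WPBailey

end

/-!
Insert the WP-Bailey relation into the first `β`-series and, for each `j`, collect the terms with
`α_j`. For `j ≥ 1` they form a nonterminating very-well-poised `₆φ₅` series, which is summed by
comparing its values at the arguments `x` and `q x`; the row `j = 0`, where `α_0 = 1`, is a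
degenerate case of that sum and gives Lambert series `∑ x q^i / (1 - x q^i)`. So the left-hand side
is a combination of the Lambert series for `(a, k, z)` and for `(1/a, 1/k, 1/z)`, that is, of
logarithmic derivatives `ζ` of the theta function `θ(x) = (x, q/x; q)_∞`. The addition formula for
`ζ` evaluates it. To prove that formula, subtract from the Wronskian of `θ(x)` and `θ(x/z)` the
multiple of `θ(x/a) θ(ax/z)` that makes the difference vanish at `x = 1` and `x = z`. All these
functions acquire the same factor under `x ↦ q x`, so the quotient of the difference by
`θ(x) θ(x/z)` has no poles and is constant by Liouville's theorem on `ℂˣ / q^ℤ`.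
-/

namespace WPBailey

open Filter Finset Topology

section QPochhammer

variable {q x : ℂ}

@[simp] lemma qPoch_zero (x q : ℂ) : qPoch x q 0 = 1 := by simp [qPoch]

@[simp] lemma qPoch_one (x q : ℂ) : qPoch x q 1 = 1 - x := by simp [qPoch]

lemma qPoch_succ (x q : ℂ) (n : ℕ) : qPoch x q (n + 1) = qPoch x q n * (1 - x * q ^ n) :=
  prod_range_succ _ _

lemma qPoch_add (x q : ℂ) (m n : ℕ) :
    qPoch x q (m + n) = qPoch x q m * qPoch (x * q ^ m) q n := by
  simp only [qPoch, prod_range_add, pow_add, mul_assoc]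

lemma qPoch_succ' (x q : ℂ) (n : ℕ) : qPoch x q (n + 1) = (1 - x) * qPoch (x * q) q n := by
  rw [add_comm, qPoch_add, qPoch_one, pow_one]

lemma one_sub_mul_qPoch_mul (x q : ℂ) (n : ℕ) :
    (1 - x) * qPoch (x * q) q n = qPoch x q n * (1 - x * q ^ n) := by
  rw [← qPoch_succ', qPoch_succ]

lemma qPoch_ne_zero (h : ∀ i : ℕ, 1 - x * q ^ i ≠ 0) (n : ℕ) : qPoch x q n ≠ 0 :=
  prod_ne_zero_iff.mpr fun i _ => h i

lemma one_sub_mul_pow_ne_zero_of_norm_lt_one (hq : ‖q‖ < 1) (hx : ‖x‖ < 1) (i : ℕ) :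
    1 - x * q ^ i ≠ 0 := by
  have hlt : ‖x * q ^ i‖ < 1 := by
    rw [norm_mul, norm_pow]
    exact mul_lt_one_of_nonneg_of_lt_one_left (norm_nonneg _) hx
      (pow_le_one₀ (norm_nonneg _) hq.le)
  exact sub_ne_zero.mpr fun h => by simp [← h] at hlt

lemma one_sub_mul_pow_ne_zero_of_forall_ne_zpow (h : ∀ m : ℤ, x ≠ q ^ m) (i : ℕ) :
    1 - x * q ^ i ≠ 0 := by
  refine sub_ne_zero.mpr fun h1 => h (-i) ?_
  rw [zpow_neg, zpow_natCast]
  exact eq_inv_of_mul_eq_one_left h1.symm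

lemma inv_ne_zpow (h : ∀ m : ℤ, x ≠ q ^ m) (m : ℤ) : x⁻¹ ≠ q ^ m := fun h1 =>
  h (-m) (by rw [zpow_neg, ← h1, inv_inv])

lemma one_sub_div_mul_pow_ne_zero_of_forall_ne_zpow (h : ∀ m : ℤ, x ≠ q ^ m) (i : ℕ) :
    1 - q / x * q ^ i ≠ 0 := by
  rw [show q / x * q ^ i = x⁻¹ * q ^ (i + 1) by ring]
  exact one_sub_mul_pow_ne_zero_of_forall_ne_zpow (inv_ne_zpow h) _

lemma summable_norm_mul_pow (hq : ‖q‖ < 1) (x : ℂ) : Summable fun i : ℕ => ‖x * q ^ i‖ := by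
  simp only [norm_mul, norm_pow]
  exact (summable_geometric_of_lt_one (norm_nonneg _) hq).mul_left _

lemma tendsto_qPoch (hq : ‖q‖ < 1) (x : ℂ) :
    Tendsto (fun n => qPoch x q n) atTop (𝓝 (qPochInf x q)) := by
  have hmul := multipliable_one_add_of_summable (f := fun i : ℕ => -(x * q ^ i))
    (by simpa only [norm_neg] using summable_norm_mul_pow hq x)
  simp only [← sub_eq_add_neg] at hmul
  exact hmul.hasProd.tendsto_prod_nat

lemma qPochInf_ne_zero (hq : ‖q‖ < 1) (h : ∀ i : ℕ, 1 - x * q ^ i ≠ 0) : qPochInf x q ≠ 0 := by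
  simp only [qPochInf, sub_eq_add_neg] at h ⊢
  exact tprod_one_add_ne_zero_of_summable h
    (by simpa only [norm_neg] using summable_norm_mul_pow hq x)

lemma qPochInf_eq_qPoch_mul (hq : ‖q‖ < 1) (x : ℂ) (n : ℕ) :
    qPochInf x q = qPoch x q n * qPochInf (x * q ^ n) q := by
  refine tendsto_nhds_unique ((tendsto_add_atTop_iff_nat n).mpr (tendsto_qPoch hq x)) ?_
  refine ((tendsto_qPoch hq (x * q ^ n)).const_mul (qPoch x q n)).congr fun m => ?_
  rw [add_comm, qPoch_add]

lemma qPochInf_eq_one_sub_mul (hq : ‖q‖ < 1) (x : ℂ) :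
    qPochInf x q = (1 - x) * qPochInf (x * q) q := by
  simpa using qPochInf_eq_qPoch_mul hq x 1

lemma exists_norm_qPoch_mul_pow_le (hq : ‖q‖ < 1) (x : ℂ) :
    ∃ C : ℝ, 0 < C ∧ ∀ N n : ℕ, ‖qPoch (x * q ^ N) q n‖ ≤ C := by
  refine ⟨Real.exp (∑' i : ℕ, ‖x * q ^ i‖), Real.exp_pos _, fun N n => ?_⟩
  have hfactor : ∀ i, ‖1 - x * q ^ N * q ^ i‖ ≤ Real.exp ‖x * q ^ (N + i)‖ := fun i => by
    rw [mul_assoc, ← pow_add]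
    refine (norm_sub_le _ _).trans ?_
    rw [norm_one, add_comm]
    exact Real.add_one_le_exp _
  calc ‖qPoch (x * q ^ N) q n‖
      ≤ ∏ i ∈ range n, Real.exp ‖x * q ^ (N + i)‖ := by
        rw [qPoch, norm_prod]
        exact prod_le_prod (fun _ _ => norm_nonneg _) fun i _ => hfactor i
    _ = Real.exp (∑ i ∈ range n, ‖x * q ^ (N + i)‖) := (Real.exp_sum _ _).symm
    _ ≤ Real.exp (∑ i ∈ range (N + n), ‖x * q ^ i‖) := by
        rw [sum_range_add]
        gcongr
        exact le_add_of_nonneg_left (sum_nonneg fun _ _ => norm_nonneg _)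
    _ ≤ Real.exp (∑' i : ℕ, ‖x * q ^ i‖) := by
        gcongr
        exact (summable_norm_mul_pow hq x).sum_le_tsum _ fun _ _ => norm_nonneg _

lemma exists_norm_inv_qPoch_mul_pow_le (hq : ‖q‖ < 1) (h : ∀ i : ℕ, 1 - x * q ^ i ≠ 0) :
    ∃ C : ℝ, 0 < C ∧ ∀ N n : ℕ, ‖(qPoch (x * q ^ N) q n)⁻¹‖ ≤ C := by
  obtain ⟨C, hC, hle⟩ := exists_norm_qPoch_mul_pow_le hq x
  obtain ⟨D, hD, hinv⟩ := (Metric.isBounded_range_of_tendsto _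
    ((tendsto_qPoch hq x).inv₀ (qPochInf_ne_zero hq h))).exists_pos_norm_le
  refine ⟨D * C, by positivity, fun N n => ?_⟩
  have hsplit : (qPoch (x * q ^ N) q n)⁻¹ = (qPoch x q (N + n))⁻¹ * qPoch x q N := by
    have := qPoch_ne_zero h N
    rw [qPoch_add]; field_simp
  rw [hsplit]
  exact norm_mul_le_of_le (hinv _ ⟨_, rfl⟩) (by simpa using hle 0 N)

/-- The Lambert series `∑_{i ≥ 0} x q^i / (1 - x q^i)`, which is `-x` times the logarithmic
derivative of `(x;q)_∞`. -/
noncomputable def lambert (x q : ℂ) : ℂ := ∑' i : ℕ, x * q ^ i / (1 - x * q ^ i)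

lemma hasSum_lambert (hq : ‖q‖ < 1) (h : ∀ i : ℕ, 1 - x * q ^ i ≠ 0) :
    HasSum (fun i : ℕ => x * q ^ i / (1 - x * q ^ i)) (lambert x q) := by
  obtain ⟨C, -, hC⟩ := exists_norm_inv_qPoch_mul_pow_le hq h
  refine (Summable.of_norm_bounded ((summable_norm_mul_pow hq x).mul_right C) fun i => ?_).hasSum
  rw [div_eq_mul_inv]
  exact norm_mul_le_of_le le_rfl (by simpa only [qPoch_one] using hC i 1)

lemma lambert_eq_add_lambert_mul (hq : ‖q‖ < 1) (h : ∀ i : ℕ, 1 - x * q ^ i ≠ 0) :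
    lambert x q = x / (1 - x) + lambert (x * q) q := by
  rw [lambert, (hasSum_lambert hq h).summable.tsum_eq_zero_add, lambert]
  simp only [pow_zero, mul_one, pow_succ', mul_assoc]

end QPochhammer

section SixPhiFive

/-- The part `(xbce, cq; q)_m (b, e; q)_{m+1} x^{m+1} / ((q;q)_m (xbc, xbe, xce; q)_{m+1})` that is
common to the terms of the `₆φ₅` series `sixPhiFiveTerm` and to their antidifference. -/
noncomputable def sixPhiFiveCore (q x b c e : ℂ) (m : ℕ) : ℂ :=
  qPoch (x * b * c * e) q m * qPoch b q (m + 1) * qPoch (c * q) q m * qPoch e q (m + 1) *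
      x ^ (m + 1) /
    (qPoch q q m * qPoch (x * b * c) q (m + 1) * qPoch (x * b * e) q (m + 1) *
      qPoch (x * c * e) q (m + 1))

/-- The term of index `m + 1` of the very-well-poised series `₆φ₅` with parameters `A; b, c, e`,
divided by `1 - c` so that `c = 1` is allowed. The series is parametrised by its argument
`x = A q / (b c e)` instead of `A`, which makes `A q = x b c e` and `A q / b = x c e`. -/
noncomputable def sixPhiFiveTerm (q x b c e : ℂ) (m : ℕ) : ℂ :=
  sixPhiFiveCore q x b c e m * (1 - x * b * c * e * q ^ (2 * m + 1)) / (1 - q * q ^ m)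

/-- The conditions under which the series `∑ sixPhiFiveTerm q x b c e m` converges and has no
vanishing denominator. -/
structure SixPhiFiveRegular (q x b c e : ℂ) : Prop where
  norm_base_lt : ‖q‖ < 1
  norm_arg_lt : ‖x‖ < 1
  bc : ∀ i : ℕ, 1 - x * b * c * q ^ i ≠ 0
  be : ∀ i : ℕ, 1 - x * b * e * q ^ i ≠ 0
  ce : ∀ i : ℕ, 1 - x * c * e * q ^ i ≠ 0

/-- The ratio of the sums of the `₆φ₅` series with arguments `x` and `x q`. -/
noncomputable def sixPhiFiveRatio (x b c e : ℂ) : ℂ :=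
  (1 - x * b * c * e) * (1 - x * b) * (1 - x * c) * (1 - x * e) /
    ((1 - x) * (1 - x * b * c) * (1 - x * b * e) * (1 - x * c * e))

variable {q x b c e : ℂ}

namespace SixPhiFiveRegular

lemma one_sub_base (h : SixPhiFiveRegular q x b c e) (i : ℕ) : 1 - q * q ^ i ≠ 0 :=
  one_sub_mul_pow_ne_zero_of_norm_lt_one h.norm_base_lt h.norm_base_lt i

lemma one_sub_arg (h : SixPhiFiveRegular q x b c e) (i : ℕ) : 1 - x * q ^ i ≠ 0 :=
  one_sub_mul_pow_ne_zero_of_norm_lt_one h.norm_base_lt h.norm_arg_lt i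

lemma mul_pow (h : SixPhiFiveRegular q x b c e) (N : ℕ) :
    SixPhiFiveRegular q (x * q ^ N) b c e where
  norm_base_lt := h.norm_base_lt
  norm_arg_lt := by
    rw [norm_mul, norm_pow]
    exact mul_lt_one_of_nonneg_of_lt_one_left (norm_nonneg _) h.norm_arg_lt
      (pow_le_one₀ (norm_nonneg _) h.norm_base_lt.le)
  bc i := by convert h.bc (N + i) using 2; ring
  be i := by convert h.be (N + i) using 2; ring
  ce i := by convert h.ce (N + i) using 2; ring

end SixPhiFiveRegular

lemma sixPhiFiveCore_succ (q x b c e : ℂ) (m : ℕ) :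
    sixPhiFiveCore q x b c e (m + 1) = sixPhiFiveCore q x b c e m *
      ((1 - x * b * c * e * q ^ m) * (1 - b * q ^ (m + 1)) * (1 - c * q ^ (m + 1)) *
          (1 - e * q ^ (m + 1)) * x /
        ((1 - q * q ^ m) * (1 - x * b * c * q ^ (m + 1)) * (1 - x * b * e * q ^ (m + 1)) *
          (1 - x * c * e * q ^ (m + 1)))) := by
  simp only [sixPhiFiveCore, div_mul_div_comm, qPoch_succ _ _ (m + 1), qPoch_succ (c * q) q m,
    qPoch_succ q q m, qPoch_succ (x * b * c * e) q m, pow_succ x (m + 1)]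
  congr 1 <;> ring

lemma sixPhiFiveRatio_mul_core (q x b c e : ℂ) (m : ℕ) :
    sixPhiFiveRatio x b c e * sixPhiFiveCore q (x * q) b c e m = sixPhiFiveCore q x b c e m *
      (q ^ (m + 1) * (1 - x * b * c * e * q ^ m) * (1 - x * b) * (1 - x * c) * (1 - x * e) /
        ((1 - x) * (1 - x * b * c * q ^ (m + 1)) * (1 - x * b * e * q ^ (m + 1)) *
          (1 - x * c * e * q ^ (m + 1)))) := by
  have hy := one_sub_mul_qPoch_mul (x * b * c * e) q m
  have hbc := one_sub_mul_qPoch_mul (x * b * c) q (m + 1)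
  have hbe := one_sub_mul_qPoch_mul (x * b * e) q (m + 1)
  have hce := one_sub_mul_qPoch_mul (x * c * e) q (m + 1)
  rw [sixPhiFiveRatio, sixPhiFiveCore, sixPhiFiveCore, div_mul_div_comm, div_mul_div_comm,
    show x * q * b * c * e = x * b * c * e * q by ring, show x * q * b * c = x * b * c * q by ring,
    show x * q * b * e = x * b * e * q by ring, show x * q * c * e = x * c * e * q by ring]
  congr 1
  · linear_combination (1 - x * b) * (1 - x * c) * (1 - x * e) * qPoch b q (m + 1) *
      qPoch (c * q) q m * qPoch e q (m + 1) * (x * q) ^ (m + 1) * hy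
  · calc _ = (1 - x) * qPoch q q m * ((1 - x * b * c) * qPoch (x * b * c * q) q (m + 1)) *
          ((1 - x * b * e) * qPoch (x * b * e * q) q (m + 1)) *
          ((1 - x * c * e) * qPoch (x * c * e * q) q (m + 1)) := by ring
      _ = _ := by rw [hbc, hbe, hce]; ring

lemma sixPhiFiveTerm_sub_ratio_mul (h : SixPhiFiveRegular q x b c e) (m : ℕ) :
    sixPhiFiveTerm q x b c e m - sixPhiFiveRatio x b c e * sixPhiFiveTerm q (x * q) b c e m =
      sixPhiFiveCore q x b c e m * (1 - x * (x * b * c * e) * q ^ m) / (1 - x) -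
      sixPhiFiveCore q x b c e (m + 1) * (1 - x * (x * b * c * e) * q ^ (m + 1)) / (1 - x) := by
  have hx : 1 - x ≠ 0 := by simpa using h.one_sub_arg 0
  have hq := h.one_sub_base m
  have hbc := h.bc (m + 1)
  have hbe := h.be (m + 1)
  have hce := h.ce (m + 1)
  have hratio := sixPhiFiveRatio_mul_core q x b c e m
  calc _ = sixPhiFiveCore q x b c e m * (1 - x * b * c * e * q ^ (2 * m + 1)) / (1 - q * q ^ m) -
        sixPhiFiveRatio x b c e * sixPhiFiveCore q (x * q) b c e m *
          (1 - x * b * c * e * q ^ (2 * m + 2)) / (1 - q * q ^ m) := by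
        simp only [sixPhiFiveTerm]; ring
    _ = _ := by
        rw [hratio, sixPhiFiveCore_succ]
        field_simp
        ring

lemma exists_norm_sixPhiFiveCore_le (h : SixPhiFiveRegular q x b c e) :
    ∃ C : ℝ, ∀ N i j m : ℕ,
      ‖sixPhiFiveCore q (x * q ^ N) (b * q ^ i) (c * q ^ j) e m‖ ≤ C * ‖x * q ^ N‖ ^ (m + 1) := by
  have hq := h.norm_base_lt
  obtain ⟨Cy, -, hy⟩ := exists_norm_qPoch_mul_pow_le hq (x * b * c * e)
  obtain ⟨Cb, -, hb⟩ := exists_norm_qPoch_mul_pow_le hq b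
  obtain ⟨Cc, -, hc⟩ := exists_norm_qPoch_mul_pow_le hq c
  obtain ⟨Ce, -, he⟩ := exists_norm_qPoch_mul_pow_le hq e
  obtain ⟨Dq, -, hbase⟩ := exists_norm_inv_qPoch_mul_pow_le hq h.one_sub_base
  obtain ⟨Dbc, -, hbc⟩ := exists_norm_inv_qPoch_mul_pow_le hq h.bc
  obtain ⟨Dbe, -, hbe⟩ := exists_norm_inv_qPoch_mul_pow_le hq h.be
  obtain ⟨Dce, -, hce⟩ := exists_norm_inv_qPoch_mul_pow_le hq h.ce
  refine ⟨Cy * Cb * Cc * Ce * Dq * Dbc * Dbe * Dce, fun N i j m => ?_⟩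
  have hsplit : sixPhiFiveCore q (x * q ^ N) (b * q ^ i) (c * q ^ j) e m =
      qPoch (x * b * c * e * q ^ (N + i + j)) q m * qPoch (b * q ^ i) q (m + 1) *
        qPoch (c * q ^ (j + 1)) q m * qPoch (e * q ^ 0) q (m + 1) *
        (qPoch (q * q ^ 0) q m)⁻¹ * (qPoch (x * b * c * q ^ (N + i + j)) q (m + 1))⁻¹ *
        (qPoch (x * b * e * q ^ (N + i)) q (m + 1))⁻¹ *
        (qPoch (x * c * e * q ^ (N + j)) q (m + 1))⁻¹ * (x * q ^ N) ^ (m + 1) := by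
    rw [sixPhiFiveCore, pow_zero, mul_one, mul_one,
      show x * q ^ N * (b * q ^ i) * (c * q ^ j) * e = x * b * c * e * q ^ (N + i + j) by ring,
      show x * q ^ N * (b * q ^ i) * (c * q ^ j) = x * b * c * q ^ (N + i + j) by ring,
      show x * q ^ N * (b * q ^ i) * e = x * b * e * q ^ (N + i) by ring,
      show x * q ^ N * (c * q ^ j) * e = x * c * e * q ^ (N + j) by ring,
      show c * q ^ j * q = c * q ^ (j + 1) by ring]
    ring
  rw [hsplit, norm_mul, norm_pow]
  gcongr
  refine norm_mul_le_of_le (norm_mul_le_of_le (norm_mul_le_of_le (norm_mul_le_of_le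
    (norm_mul_le_of_le (norm_mul_le_of_le (norm_mul_le_of_le ?_ ?_) ?_) ?_) ?_) ?_) ?_) ?_
  exacts [hy _ _, hb _ _, hc _ _, he _ _, hbase _ _, hbc _ _, hbe _ _, hce _ _]

lemma exists_norm_sixPhiFiveTerm_le (h : SixPhiFiveRegular q x b c e) :
    ∃ C : ℝ, ∀ N i j m : ℕ,
      ‖sixPhiFiveTerm q (x * q ^ N) (b * q ^ i) (c * q ^ j) e m‖ ≤ C * ‖x * q ^ N‖ ^ (m + 1) := by
  obtain ⟨C, hcore⟩ := exists_norm_sixPhiFiveCore_le h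
  obtain ⟨Cy, -, hy⟩ := exists_norm_qPoch_mul_pow_le h.norm_base_lt (x * b * c * e)
  obtain ⟨Dq, -, hbase⟩ := exists_norm_inv_qPoch_mul_pow_le h.norm_base_lt h.one_sub_base
  refine ⟨C * Cy * Dq, fun N i j m => ?_⟩
  have hnum : ‖1 - x * q ^ N * (b * q ^ i) * (c * q ^ j) * e * q ^ (2 * m + 1)‖ ≤ Cy := by
    convert hy (N + i + j + (2 * m + 1)) 1 using 2
    rw [qPoch_one]
    ring
  have hden : ‖(1 - q * q ^ m)⁻¹‖ ≤ Dq := by simpa only [qPoch_one] using hbase m 1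
  calc _ ≤ C * ‖x * q ^ N‖ ^ (m + 1) * Cy * Dq := by
        rw [sixPhiFiveTerm, div_eq_mul_inv]
        exact norm_mul_le_of_le (norm_mul_le_of_le (hcore N i j m) hnum) hden
    _ = C * Cy * Dq * ‖x * q ^ N‖ ^ (m + 1) := by ring

lemma summable_sixPhiFiveTerm (h : SixPhiFiveRegular q x b c e) :
    Summable (sixPhiFiveTerm q x b c e) := by
  obtain ⟨C, hC⟩ := exists_norm_sixPhiFiveTerm_le h
  refine .of_norm_bounded (((summable_geometric_of_lt_one (norm_nonneg x)
    h.norm_arg_lt).comp_injective (add_left_injective 1)).mul_left C) fun m => ?_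
  simpa using hC 0 0 0 m

lemma tendsto_sixPhiFiveCore (h : SixPhiFiveRegular q x b c e) :
    Tendsto (sixPhiFiveCore q x b c e) atTop (𝓝 0) := by
  obtain ⟨C, hC⟩ := exists_norm_sixPhiFiveCore_le h
  refine squeeze_zero_norm (fun m => by simpa using hC 0 0 0 m) ?_
  simpa using (((tendsto_pow_atTop_nhds_zero_of_lt_one (norm_nonneg x)
    h.norm_arg_lt).comp (tendsto_add_atTop_nat 1)).const_mul C)

lemma tsum_sixPhiFiveTerm_eq_add_ratio_mul (h : SixPhiFiveRegular q x b c e) :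
    ∑' m, sixPhiFiveTerm q x b c e m =
      x * (1 - b) * (1 - e) * (1 - x * (x * b * c * e)) /
          ((1 - x) * (1 - x * b * c) * (1 - x * b * e) * (1 - x * c * e)) +
        sixPhiFiveRatio x b c e * ∑' m, sixPhiFiveTerm q (x * q) b c e m := by
  have hsum := summable_sixPhiFiveTerm h
  have hsum' := summable_sixPhiFiveTerm (h.mul_pow 1)
  rw [pow_one] at hsum'
  set G : ℕ → ℂ := fun m =>
    sixPhiFiveCore q x b c e m * (1 - x * (x * b * c * e) * q ^ m) / (1 - x) with hG
  have hstep : ∀ m, sixPhiFiveTerm q x b c e m -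
      sixPhiFiveRatio x b c e * sixPhiFiveTerm q (x * q) b c e m = G m - G (m + 1) :=
    sixPhiFiveTerm_sub_ratio_mul h
  have hG_lim : Tendsto G atTop (𝓝 0) := by
    have hpow := tendsto_pow_atTop_nhds_zero_of_norm_lt_one h.norm_base_lt
    simpa using ((tendsto_sixPhiFiveCore h).mul
      ((hpow.const_mul (x * (x * b * c * e))).const_sub 1)).div_const (1 - x)
  have hG_zero : G 0 = x * (1 - b) * (1 - e) * (1 - x * (x * b * c * e)) /
      ((1 - x) * (1 - x * b * c) * (1 - x * b * e) * (1 - x * c * e)) := by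
    simp only [hG, sixPhiFiveCore, zero_add, qPoch_zero, qPoch_one, pow_zero, pow_one]
    rw [div_mul_eq_mul_div, div_div]
    ring
  have htelescope : HasSum (fun m => sixPhiFiveTerm q x b c e m -
      sixPhiFiveRatio x b c e * sixPhiFiveTerm q (x * q) b c e m) (G 0) := by
    refine ((hsum.sub (hsum'.mul_left _)).hasSum_iff_tendsto_nat).mpr ?_
    simp only [hstep, sum_range_sub']
    simpa only [sub_zero] using hG_lim.const_sub (G 0)
  rw [← hG_zero, ← htelescope.tsum_eq, hsum.tsum_sub (hsum'.mul_left _), tsum_mul_left]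
  ring

lemma tendsto_tsum_sixPhiFiveTerm (h : SixPhiFiveRegular q x b c e) :
    Tendsto (fun N => ∑' m, sixPhiFiveTerm q (x * q ^ N) b c e m) atTop (𝓝 0) := by
  obtain ⟨C, hC⟩ := exists_norm_sixPhiFiveTerm_le h
  have hbound : ∀ N, ‖∑' m, sixPhiFiveTerm q (x * q ^ N) b c e m‖ ≤
      C * ‖x * q ^ N‖ * (1 - ‖x * q ^ N‖)⁻¹ := fun N => by
    refine tsum_of_norm_bounded
      ((hasSum_geometric_of_lt_one (norm_nonneg _) (h.mul_pow N).norm_arg_lt).mul_left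
        (C * ‖x * q ^ N‖)) fun m => ?_
    simpa [pow_succ', mul_assoc] using hC N 0 0 m
  have hlim : Tendsto (fun N => ‖x * q ^ N‖) atTop (𝓝 0) :=
    (summable_norm_mul_pow h.norm_base_lt x).tendsto_atTop_zero
  refine squeeze_zero_norm hbound ?_
  simpa using (hlim.const_mul C).mul ((hlim.const_sub 1).inv₀ (by simp))

lemma one_add_tsum_sixPhiFiveTerm_mul_one_sub (h : SixPhiFiveRegular q x b c e) :
    (1 + (1 - c) * ∑' m, sixPhiFiveTerm q x b c e m) *
        ((1 - x) * (1 - x * b * c) * (1 - x * b * e) * (1 - x * c * e)) =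
      (1 - x * b * c * e) * (1 - x * b) * (1 - x * c) * (1 - x * e) *
        (1 + (1 - c) * ∑' m, sixPhiFiveTerm q (x * q) b c e m) := by
  have hden : (1 - x) * (1 - x * b * c) * (1 - x * b * e) * (1 - x * c * e) ≠ 0 :=
    mul_ne_zero (mul_ne_zero (mul_ne_zero (by simpa using h.one_sub_arg 0)
      (by simpa using h.bc 0)) (by simpa using h.be 0)) (by simpa using h.ce 0)
  have hconst := div_mul_cancel₀ (x * (1 - b) * (1 - e) * (1 - x * (x * b * c * e))) hden
  have hratio : sixPhiFiveRatio x b c e * _ = _ := div_mul_cancel₀ _ hden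
  rw [tsum_sixPhiFiveTerm_eq_add_ratio_mul h]
  linear_combination (1 - c) * hconst +
    (1 - c) * (∑' m, sixPhiFiveTerm q (x * q) b c e m) * hratio

lemma one_add_tsum_sixPhiFiveTerm_mul_qPoch (h : SixPhiFiveRegular q x b c e) (N : ℕ) :
    (1 + (1 - c) * ∑' m, sixPhiFiveTerm q x b c e m) *
        (qPoch x q N * qPoch (x * b * c) q N * qPoch (x * b * e) q N * qPoch (x * c * e) q N) =
      qPoch (x * b * c * e) q N * qPoch (x * b) q N * qPoch (x * c) q N * qPoch (x * e) q N *
        (1 + (1 - c) * ∑' m, sixPhiFiveTerm q (x * q ^ N) b c e m) := by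
  induction N with
  | zero => simp [mul_comm]
  | succ N ih =>
    have hstep := one_add_tsum_sixPhiFiveTerm_mul_one_sub (h.mul_pow N)
    rw [show x * q ^ N * q = x * q ^ (N + 1) by ring] at hstep
    simp only [qPoch_succ]
    linear_combination (1 - x * q ^ N) * (1 - x * q ^ N * b * c) * (1 - x * q ^ N * b * e) *
      (1 - x * q ^ N * c * e) * ih +
      qPoch (x * b * c * e) q N * qPoch (x * b) q N * qPoch (x * c) q N * qPoch (x * e) q N * hstep

theorem one_add_tsum_sixPhiFiveTerm (h : SixPhiFiveRegular q x b c e) :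
    1 + (1 - c) * ∑' m, sixPhiFiveTerm q x b c e m =
      qPochInf (x * b * c * e) q * qPochInf (x * b) q * qPochInf (x * c) q * qPochInf (x * e) q /
        (qPochInf x q * qPochInf (x * b * c) q * qPochInf (x * b * e) q *
          qPochInf (x * c * e) q) := by
  have hq := h.norm_base_lt
  have hden : qPochInf x q * qPochInf (x * b * c) q * qPochInf (x * b * e) q *
      qPochInf (x * c * e) q ≠ 0 :=
    mul_ne_zero (mul_ne_zero (mul_ne_zero (qPochInf_ne_zero hq h.one_sub_arg)
      (qPochInf_ne_zero hq h.bc)) (qPochInf_ne_zero hq h.be)) (qPochInf_ne_zero hq h.ce)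
  have hlim := ((tendsto_tsum_sixPhiFiveTerm h).const_mul (1 - c)).const_add 1
  rw [mul_zero, add_zero] at hlim
  rw [eq_div_iff hden, ← mul_one (_ * qPochInf (x * e) q)]
  refine tendsto_nhds_unique ((((((tendsto_qPoch hq _).mul (tendsto_qPoch hq _)).mul
    (tendsto_qPoch hq _)).mul (tendsto_qPoch hq _)).const_mul _).congr
      (one_add_tsum_sixPhiFiveTerm_mul_qPoch h)) ?_
  exact ((((tendsto_qPoch hq _).mul (tendsto_qPoch hq _)).mul (tendsto_qPoch hq _)).mul
    (tendsto_qPoch hq _)).mul hlim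

lemma tsum_sixPhiFiveTerm_one_eq_add (h : SixPhiFiveRegular q x b 1 e) (hb : 1 - x * b ≠ 0)
    (he : 1 - x * e ≠ 0) :
    ∑' m, sixPhiFiveTerm q x b 1 e m =
      x * b * e / (1 - x * b * e) - x * b / (1 - x * b) + x / (1 - x) - x * e / (1 - x * e) +
        ∑' m, sixPhiFiveTerm q (x * q) b 1 e m := by
  have hx : 1 - x ≠ 0 := by simpa using h.one_sub_arg 0
  have hbe : 1 - x * b * e ≠ 0 := by simpa using h.be 0
  have hratio : sixPhiFiveRatio x b 1 e = 1 := by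
    rw [sixPhiFiveRatio]
    simp only [mul_one]
    exact (div_eq_one_iff_eq (by positivity)).mpr (by ring)
  rw [tsum_sixPhiFiveTerm_eq_add_ratio_mul h, hratio, one_mul]
  simp only [mul_one]
  congr 1
  field_simp
  ring

theorem tsum_sixPhiFiveTerm_one (h : SixPhiFiveRegular q x b 1 e)
    (hb : ∀ i : ℕ, 1 - x * b * q ^ i ≠ 0) (he : ∀ i : ℕ, 1 - x * e * q ^ i ≠ 0) :
    ∑' m, sixPhiFiveTerm q x b 1 e m =
      lambert (x * b * e) q - lambert (x * b) q + lambert x q - lambert (x * e) q := by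
  have hq := h.norm_base_lt
  set f : ℕ → ℂ := fun i => x * b * e * q ^ i / (1 - x * b * e * q ^ i) -
    x * b * q ^ i / (1 - x * b * q ^ i) + x * q ^ i / (1 - x * q ^ i) -
    x * e * q ^ i / (1 - x * e * q ^ i) with hf
  have hstep : ∀ N, ∑' m, sixPhiFiveTerm q (x * q ^ N) b 1 e m =
      f N + ∑' m, sixPhiFiveTerm q (x * q ^ (N + 1)) b 1 e m := fun N => by
    have := tsum_sixPhiFiveTerm_one_eq_add (h.mul_pow N) (by simpa only [mul_right_comm] using hb N)
      (by simpa only [mul_right_comm] using he N)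
    simpa only [hf, pow_succ, mul_assoc, mul_comm, mul_left_comm] using this
  have hpartial : ∀ N, ∑ i ∈ range N, f i = ∑' m, sixPhiFiveTerm q x b 1 e m -
      ∑' m, sixPhiFiveTerm q (x * q ^ N) b 1 e m := fun N => by
    simp only [eq_sub_of_add_eq (hstep _).symm, sum_range_sub', pow_zero, mul_one]
  have hlim := (tendsto_tsum_sixPhiFiveTerm h).const_sub (∑' m, sixPhiFiveTerm q x b 1 e m)
  rw [sub_zero] at hlim
  refine tendsto_nhds_unique (hlim.congr fun N => (hpartial N).symm) ?_
  exact ((((hasSum_lambert hq h.be).sub (hasSum_lambert hq hb)).add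
    (hasSum_lambert hq h.one_sub_arg)).sub (hasSum_lambert hq he)).tendsto_sum_nat

end SixPhiFive

section DoubleSeries

lemma seriesHasSum_iff_tendsto_sum_range {u : ℕ → ℂ} {S : ℂ} :
    SeriesHasSum u S ↔ Tendsto (fun N => ∑ n ∈ range N, u n) atTop (𝓝 (u 0 + S)) := by
  have hsum : ∀ N, ∑ n ∈ range (N + 1), u n = u 0 + ∑ n ∈ Icc 1 N, u n := fun N => by
    rw [range_eq_Ico, sum_eq_sum_Ico_succ_bot N.succ_pos]
    rfl
  rw [← tendsto_add_atTop_iff_nat 1]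
  simp only [hsum, tendsto_const_add_iff, SeriesHasSum]

lemma SeriesHasSum.tendsto_zero {u : ℕ → ℂ} {S : ℂ} (h : SeriesHasSum u S) :
    Tendsto u atTop (𝓝 0) := by
  have hlim := seriesHasSum_iff_tendsto_sum_range.mp h
  simpa [sum_range_succ] using ((tendsto_add_atTop_iff_nat 1).mpr hlim).sub hlim

lemma tendsto_sum_range_mul_of_geometric {V : ℕ → ℂ} {E : ℕ → ℕ → ℂ} {C r : ℝ} (hr0 : 0 ≤ r)
    (hr : r < 1) (hV : Tendsto V atTop (𝓝 0)) (hE : ∀ j m, ‖E j m‖ ≤ C * r ^ m) :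
    Tendsto (fun N => ∑ j ∈ range N, V j * E j (N - j)) atTop (𝓝 0) := by
  obtain ⟨D, -, hVD⟩ := (Metric.isBounded_range_of_tendsto _ hV).exists_pos_norm_le
  have hC : 0 ≤ C := by simpa using (norm_nonneg _).trans (hE 0 0)
  have hbound : ∀ N m, ‖V (N - 1 - m) * E (N - 1 - m) (m + 1)‖ ≤
      ‖V (N - 1 - m)‖ * (C * r ^ (m + 1)) := fun N m => norm_mul_le_of_le le_rfl (hE _ _)
  set F : ℕ → ℕ → ℂ := fun N =>
    Set.indicator (range N) fun m => V (N - 1 - m) * E (N - 1 - m) (m + 1) with hF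
  have hF_sum : ∀ N, ∑' m, F N m = ∑ j ∈ range N, V j * E j (N - j) := fun N => by
    rw [hF, ← sum_eq_tsum_indicator, ← sum_range_reflect]
    refine sum_congr rfl fun m hm => ?_
    have := mem_range.mp hm
    rw [show N - 1 - (N - 1 - m) = m by omega, show N - 1 - m + 1 = N - m by omega]
  have hF_le : ∀ N m, ‖F N m‖ ≤ D * (C * r ^ (m + 1)) := fun N m =>
    (norm_indicator_le_norm_self _ _).trans ((hbound N m).trans
      (mul_le_mul_of_nonneg_right (hVD _ ⟨_, rfl⟩) (by positivity)))
  have hF_lim : ∀ m, Tendsto (fun N => F N m) atTop (𝓝 0) := fun m => by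
    refine squeeze_zero_norm
      (fun N => (norm_indicator_le_norm_self _ _).trans (hbound N m)) ?_
    simpa using ((hV.comp ((tendsto_sub_atTop_nat m).comp
      (tendsto_sub_atTop_nat 1))).norm).mul_const (C * r ^ (m + 1))
  have hlim := tendsto_tsum_of_dominated_convergence
    ((((summable_geometric_of_lt_one hr0 hr).comp_injective
      (add_left_injective 1)).mul_left C).mul_left D) hF_lim (Eventually.of_forall hF_le)
  simpa only [hF_sum, tsum_zero] using hlim

/-- `∑ V j s j` may converge only conditionally, so the summations cannot simply be
interchanged: the rows are compared with their truncations. -/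
lemma tendsto_sum_range_sum_range_of_geometric {V s : ℕ → ℂ} {e : ℕ → ℕ → ℂ} {C r : ℝ} {A : ℂ}
    (hr0 : 0 ≤ r) (hr : r < 1) (hV : Tendsto V atTop (𝓝 0)) (he : ∀ j m, ‖e j m‖ ≤ C * r ^ m)
    (hs : ∀ j, HasSum (e j) (s j))
    (hA : Tendsto (fun N => ∑ j ∈ range N, V j * s j) atTop (𝓝 A)) :
    Tendsto (fun N => ∑ n ∈ range N, ∑ j ∈ range (n + 1), V j * e j (n - j)) atTop (𝓝 A) := by
  have htail : ∀ j M, ‖∑ m ∈ range M, e j m - s j‖ ≤ C / (1 - r) * r ^ M := fun j M =>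
    (norm_sub_le_of_geometric_bound_of_hasSum hr (he j) (hs j) M).trans_eq (by ring)
  have hlim := hA.add (tendsto_sum_range_mul_of_geometric hr0 hr hV htail)
  rw [add_zero] at hlim
  refine hlim.congr fun N => ?_
  rw [sum_range_diag_flip N fun j m => V j * e j m, ← sum_add_distrib]
  refine sum_congr rfl fun j _ => ?_
  rw [← mul_sum]
  ring

lemma seriesHasSum_sum_range_of_geometric {V s : ℕ → ℂ} {e : ℕ → ℕ → ℂ} {C r : ℝ} {A : ℂ}
    (hr0 : 0 ≤ r) (hr : r < 1) (hV : Tendsto V atTop (𝓝 0)) (he : ∀ j m, ‖e j m‖ ≤ C * r ^ m)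
    (hs : ∀ j, HasSum (e j) (s j)) (hA : SeriesHasSum (fun j => V j * s j) A) :
    SeriesHasSum (fun n => ∑ j ∈ range (n + 1), V j * e j (n - j))
      (V 0 * (s 0 - e 0 0) + A) := by
  rw [seriesHasSum_iff_tendsto_sum_range] at hA ⊢
  convert tendsto_sum_range_sum_range_of_geometric hr0 hr hV he hs hA using 2
  simp
  ring

end DoubleSeries

section Bailey

/-- The conditions on the parameters under which the WP-Bailey lemma `seriesHasSum_beta` holds:
convergence, and no vanishing denominator. -/
structure BaileyRegular (q a k z : ℂ) : Prop where
  norm_base_lt : ‖q‖ < 1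
  norm_arg_lt : ‖q * a / z‖ < 1
  a_ne_zero : a ≠ 0
  z_ne_zero : z ≠ 0
  one_sub_k : ∀ i : ℕ, 1 - k * q ^ i ≠ 0
  one_sub_a : ∀ i : ℕ, 1 - a * q ^ i ≠ 0
  one_sub_div : ∀ i : ℕ, 1 - q * k / z * q ^ i ≠ 0

/-- The coefficient of `α_n` in the first `α`-series, without the factor `(q;q)_{n-1}`. -/
noncomputable def alphaCoeff (q a z : ℂ) (n : ℕ) : ℂ :=
  qPoch z q n * (q * a / z) ^ n / (qPoch (q * a) q n * qPoch (q * a / z) q n)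

/-- The factor of `baileyKernel q a k z j` that depends on `j` only; by the `₆φ₅` summation it is
the reciprocal of the sum of the series by which it is multiplied. -/
noncomputable def baileyScale (q a k z : ℂ) (j : ℕ) : ℂ :=
  qPoch (q * k * q ^ j) q j * qPoch (q * a / z) q j /
    (qPoch (q * k / z) q j * qPoch (q * a * q ^ j) q j)

/-- The coefficient of `α_j` in the term of index `j + m` of the first `β`-series, divided by
`alphaCoeff q a z j`. -/
noncomputable def baileyKernel (q a k z : ℂ) (j : ℕ) : ℕ → ℂ
  | 0 => baileyScale q a k z j * qPoch q q (j - 1)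
  | m + 1 => baileyScale q a k z j * qPoch q q j *
      sixPhiFiveTerm q (q * a / z) (z * q ^ j) (q ^ j) (k / a) m

variable {q a k z : ℂ}

namespace BaileyRegular

lemma one_sub_arg (h : BaileyRegular q a k z) (i : ℕ) : 1 - q * a / z * q ^ i ≠ 0 :=
  one_sub_mul_pow_ne_zero_of_norm_lt_one h.norm_base_lt h.norm_arg_lt i

lemma one_sub_mul_k (h : BaileyRegular q a k z) (i : ℕ) : 1 - q * k * q ^ i ≠ 0 := by
  convert h.one_sub_k (i + 1) using 2; ring

lemma one_sub_mul_a (h : BaileyRegular q a k z) (i : ℕ) : 1 - q * a * q ^ i ≠ 0 := by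
  convert h.one_sub_a (i + 1) using 2; ring

lemma sixPhiFiveRegular (h : BaileyRegular q a k z) (j : ℕ) :
    SixPhiFiveRegular q (q * a / z) (z * q ^ j) (q ^ j) (k / a) where
  norm_base_lt := h.norm_base_lt
  norm_arg_lt := h.norm_arg_lt
  bc i := by
    have := h.z_ne_zero
    convert h.one_sub_a (2 * j + i + 1) using 2; field_simp; ring
  be i := by
    have := h.a_ne_zero
    have := h.z_ne_zero
    convert h.one_sub_k (j + i + 1) using 2; field_simp; ring
  ce i := by
    have := h.a_ne_zero
    convert h.one_sub_div (j + i) using 2; field_simp; ring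

end BaileyRegular

lemma exists_norm_baileyScale_le (h : BaileyRegular q a k z) :
    ∃ C : ℝ, ∀ j : ℕ, ‖baileyScale q a k z j‖ ≤ C := by
  have hq := h.norm_base_lt
  obtain ⟨Ck, -, hk⟩ := exists_norm_qPoch_mul_pow_le hq (q * k)
  obtain ⟨Cx, -, hx⟩ := exists_norm_qPoch_mul_pow_le hq (q * a / z)
  obtain ⟨Dk, -, hkz⟩ := exists_norm_inv_qPoch_mul_pow_le hq h.one_sub_div
  obtain ⟨Da, -, ha⟩ := exists_norm_inv_qPoch_mul_pow_le hq h.one_sub_mul_a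
  refine ⟨Ck * Cx * (Da * Dk), fun j => ?_⟩
  rw [baileyScale, div_eq_mul_inv, mul_inv_rev]
  exact norm_mul_le_of_le (norm_mul_le_of_le (hk j j) (by simpa using hx 0 j))
    (norm_mul_le_of_le (ha j j) (by simpa using hkz 0 j))

lemma exists_norm_baileyKernel_le (h : BaileyRegular q a k z) :
    ∃ C : ℝ, ∀ j m : ℕ, ‖baileyKernel q a k z j m‖ ≤ C * ‖q * a / z‖ ^ m := by
  obtain ⟨Cs, hs⟩ := exists_norm_baileyScale_le h
  obtain ⟨Cq, hCq, hqq⟩ := exists_norm_qPoch_mul_pow_le h.norm_base_lt q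
  obtain ⟨Ct, ht⟩ := exists_norm_sixPhiFiveTerm_le (h.sixPhiFiveRegular 0)
  have hCs : 0 ≤ Cs := (norm_nonneg _).trans (hs 0)
  have hqq' : ∀ n, ‖qPoch q q n‖ ≤ Cq := fun n => by simpa using hqq 0 n
  refine ⟨Cs * Cq * max 1 Ct, fun j m => ?_⟩
  cases m with
  | zero =>
    rw [pow_zero, mul_one]
    exact (norm_mul_le_of_le (hs j) (hqq' _)).trans
      (le_mul_of_one_le_right (by positivity) (le_max_left _ _))
  | succ m =>
    rw [mul_assoc]
    refine norm_mul_le_of_le (norm_mul_le_of_le (hs j) (hqq' j)) ?_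
    refine le_trans ?_ (mul_le_mul_of_nonneg_right (le_max_right 1 Ct) (by positivity))
    simpa using ht 0 j j m

lemma baileyScale_mul_one_add_tsum (h : BaileyRegular q a k z) (j : ℕ) :
    baileyScale q a k z j * (1 + (1 - q ^ j) *
      ∑' m, sixPhiFiveTerm q (q * a / z) (z * q ^ j) (q ^ j) (k / a) m) = 1 := by
  have hq := h.norm_base_lt
  have ha := h.a_ne_zero
  have hz := h.z_ne_zero
  have hreg := h.sixPhiFiveRegular j
  have hxb : q * a / z * (z * q ^ j) = q * a * q ^ j := by field_simp
  have hxe : q * a / z * (k / a) = q * k / z := by field_simp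
  have hxbe : q * a * q ^ j * (k / a) = q * k * q ^ j := by field_simp
  have hxce : q * a / z * q ^ j * (k / a) = q * k / z * q ^ j := by field_simp
  have hy : q * a * q ^ j * q ^ j * (k / a) = q * k * q ^ j * q ^ j := by field_simp
  rw [one_add_tsum_sixPhiFiveTerm hreg, hxb, hxe, hxbe, hxce, hy,
    qPochInf_eq_qPoch_mul hq (q * k * q ^ j) j, qPochInf_eq_qPoch_mul hq (q * a * q ^ j) j,
    qPochInf_eq_qPoch_mul hq (q * a / z) j, qPochInf_eq_qPoch_mul hq (q * k / z) j, baileyScale,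
    div_mul_div_comm]
  refine (div_eq_one_iff_eq ?_).mpr (by ring)
  have hshift {y : ℂ} (hy : ∀ i : ℕ, 1 - y * q ^ i ≠ 0) (i : ℕ) : 1 - y * q ^ j * q ^ i ≠ 0 := by
    simpa only [pow_add, mul_assoc] using hy (j + i)
  have h1 := qPoch_ne_zero h.one_sub_div j
  have h2 := qPoch_ne_zero (hshift h.one_sub_mul_a) j
  have h3 := qPoch_ne_zero h.one_sub_arg j
  have h4 := qPochInf_ne_zero hq (hshift h.one_sub_arg)
  have h5 := qPochInf_ne_zero hq (hshift (hshift h.one_sub_mul_a))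
  have h6 := qPoch_ne_zero (hshift h.one_sub_mul_k) j
  have h7 := qPochInf_ne_zero hq (hshift (hshift h.one_sub_mul_k))
  have h8 := qPochInf_ne_zero hq (hshift h.one_sub_div)
  positivity

lemma hasSum_baileyKernel_succ (h : BaileyRegular q a k z) (j : ℕ) :
    HasSum (baileyKernel q a k z (j + 1)) (qPoch q q j) := by
  have hscale := baileyScale_mul_one_add_tsum h (j + 1)
  have hsum := ((summable_sixPhiFiveTerm (h.sixPhiFiveRegular (j + 1))).hasSum.mul_left
    (baileyScale q a k z (j + 1) * qPoch q q (j + 1)))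
  convert HasSum.zero_add (f := baileyKernel q a k z (j + 1)) hsum using 1
  rw [baileyKernel, Nat.add_sub_cancel, qPoch_succ, ← pow_succ']
  linear_combination -qPoch q q j * hscale

lemma hasSum_baileyKernel_zero (h : BaileyRegular q a k z) :
    HasSum (baileyKernel q a k z 0) (1 + (lambert (q * k) q - lambert (q * a) q +
      lambert (q * a / z) q - lambert (q * k / z) q)) := by
  have ha := h.a_ne_zero
  have hz := h.z_ne_zero
  have hreg := h.sixPhiFiveRegular 0
  simp only [pow_zero, mul_one] at hreg
  have hxb : q * a / z * z = q * a := by field_simp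
  have hxe : q * a / z * (k / a) = q * k / z := by field_simp
  have hxbe : q * a * (k / a) = q * k := by field_simp
  have hsum := (summable_sixPhiFiveTerm hreg).hasSum
  rw [tsum_sixPhiFiveTerm_one hreg (by simpa only [hxb] using h.one_sub_mul_a)
    (by simpa only [hxe] using h.one_sub_div), hxb, hxe, hxbe] at hsum
  have hscale : baileyScale q a k z 0 = 1 := by simp [baileyScale]
  have hzero : baileyKernel q a k z 0 0 = 1 := by simp [baileyKernel, hscale]
  rw [← hzero]
  refine HasSum.zero_add (hsum.congr_fun ?_)
  simp [baileyKernel, hscale]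

lemma veryWellPoised_ratio {rk : ℂ} (hrk : rk ^ 2 = k) (h : ∀ i : ℕ, 1 - k * q ^ i ≠ 0) (n : ℕ) :
    qPoch (q * rk) q n * qPoch (-q * rk) q n / (qPoch rk q n * qPoch (-rk) q n) =
      (1 - k * q ^ (2 * n)) / (1 - k) := by
  have hne : ∀ i : ℕ, (1 - rk * q ^ i) * (1 - -rk * q ^ i) ≠ 0 := fun i => by
    rw [show (1 - rk * q ^ i) * (1 - -rk * q ^ i) = 1 - k * q ^ (2 * i) by rw [← hrk]; ring]
    exact h _
  have hpos := qPoch_ne_zero (fun i => left_ne_zero_of_mul (hne i)) n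
  have hneg := qPoch_ne_zero (fun i => right_ne_zero_of_mul (hne i)) n
  rw [div_eq_div_iff (mul_ne_zero hpos hneg) (by simpa using h 0), mul_comm q rk,
    show -q * rk = -rk * q by ring]
  calc _ = ((1 - rk) * qPoch (rk * q) q n) * ((1 - -rk) * qPoch (-rk * q) q n) := by
        rw [← hrk]; ring
    _ = _ := by rw [one_sub_mul_qPoch_mul, one_sub_mul_qPoch_mul, ← hrk]; ring

/-- The coefficient of `β_n` in the first `β`-series, with the square roots of `k` eliminated. -/
noncomputable def betaCoeff (q a k z : ℂ) (n : ℕ) : ℂ :=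
  (1 - k * q ^ (2 * n)) * qPoch z q n * qPoch q q (n - 1) * (q * a / z) ^ n /
    ((1 - k) * qPoch (q * k) q n * qPoch (q * k / z) q n)

lemma betaCoeff_eq (h : BaileyRegular q a k z) {rk : ℂ} (hrk : rk ^ 2 = k) (n : ℕ) :
    qPochs [q * rk, -q * rk, z] q n * qPoch q q (n - 1) /
        qPochs [rk, -rk, q * k, q * k / z] q n * (q * a / z) ^ n = betaCoeff q a k z n := by
  have hratio := veryWellPoised_ratio hrk h.one_sub_k n
  simp only [qPochs, List.map_cons, List.map_nil, List.prod_cons, List.prod_nil, mul_one]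
  calc _ = qPoch (q * rk) q n * qPoch (-q * rk) q n / (qPoch rk q n * qPoch (-rk) q n) *
        (qPoch z q n * qPoch q q (n - 1) * (q * a / z) ^ n /
          (qPoch (q * k) q n * qPoch (q * k / z) q n)) := by
        rw [div_mul_div_comm, div_mul_eq_mul_div]
        congr 1 <;> ring
    _ = _ := by
        rw [hratio, betaCoeff, div_mul_div_comm]
        congr 1 <;> ring

lemma betaCoeff_mul_eq_baileyKernel_zero (h : BaileyRegular q a k z) (j : ℕ) :
    betaCoeff q a k z j * (qPoch k q (2 * j) / qPoch (a * q) q (2 * j)) =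
      alphaCoeff q a z j * baileyKernel q a k z j 0 := by
  have hk : 1 - k ≠ 0 := by simpa using h.one_sub_k 0
  have hqk := qPoch_ne_zero h.one_sub_mul_k j
  have hqaz := qPoch_ne_zero h.one_sub_arg j
  have hlast : (1 - k * q ^ (2 * j)) * qPoch k q (2 * j) =
      (1 - k) * (qPoch (q * k) q j * qPoch (q * k * q ^ j) q j) := by
    rw [mul_comm, ← qPoch_succ, qPoch_succ', two_mul, qPoch_add, mul_comm k q]
  simp only [betaCoeff, alphaCoeff, baileyKernel, baileyScale, mul_comm a q]
  rw [two_mul, qPoch_add (q * a), ← two_mul, div_mul_div_comm, div_mul_eq_mul_div,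
    div_mul_eq_mul_div, mul_div_assoc', div_div, ← mul_div_mul_left _ _ hqaz,
    ← mul_div_mul_left (qPoch z q j * _ * _) _ (mul_ne_zero hk hqk)]
  congr 1
  · linear_combination qPoch (q * a / z) q j * qPoch z q j * qPoch q q (j - 1) *
      (q * a / z) ^ j * hlast
  · ring

lemma betaCoeff_mul_eq_baileyKernel_succ (h : BaileyRegular q a k z) (j m : ℕ) :
    betaCoeff q a k z (j + (m + 1)) * ((qPoch (k / a) q (m + 1) * qPoch k q (2 * j + (m + 1))) /
        (qPoch q q (m + 1) * qPoch (a * q) q (2 * j + (m + 1)))) =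
      alphaCoeff q a z j * baileyKernel q a k z j (m + 1) := by
  have hk : 1 - k ≠ 0 := by simpa using h.one_sub_k 0
  have hqk := qPoch_ne_zero h.one_sub_mul_k j
  have hqaz := qPoch_ne_zero h.one_sub_arg j
  have ha := h.a_ne_zero
  have hz := h.z_ne_zero
  have hterm : qPoch k q (2 * j + (m + 1)) = (1 - k) * (qPoch (q * k) q j *
      (qPoch (q * k * q ^ j) q j * qPoch (q * k * q ^ j * q ^ j) q m)) := by
    rw [← add_assoc, qPoch_succ', two_mul, add_assoc, qPoch_add, qPoch_add, mul_comm k q]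
  have hxbc : q * a / z * (z * q ^ j) * q ^ j = q * a * q ^ j * q ^ j := by field_simp
  have hxbe : q * a / z * (z * q ^ j) * (k / a) = q * k * q ^ j := by field_simp
  have hxce : q * a / z * q ^ j * (k / a) = q * k / z * q ^ j := by field_simp
  have hy : q * a * q ^ j * q ^ j * (k / a) = q * k * q ^ j * q ^ j := by field_simp
  rw [betaCoeff, alphaCoeff, baileyKernel, baileyScale, sixPhiFiveTerm, sixPhiFiveCore, hterm,
    hxbc, hxbe, hxce, hy, mul_comm a q, two_mul j, add_assoc j j, qPoch_add (q * a),
    qPoch_add (q * a * q ^ j), qPoch_add (q * k), qPoch_add (q * k / z), qPoch_add z,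
    show j + (m + 1) - 1 = j + m by omega, qPoch_add q, qPoch_succ q q m, mul_comm _ q]
  generalize q * a / z = x at *
  generalize q * k / z = y at *
  generalize k / a = e at *
  simp only [div_mul_eq_mul_div, mul_div_assoc', div_div]
  rw [← mul_div_mul_left _ _ hqaz,
    ← mul_div_mul_left (qPoch z q j * _ * _) _ (mul_ne_zero hk hqk)]
  congr 1 <;> ring

lemma betaCoeff_mul_eq_baileyKernel (h : BaileyRegular q a k z) (j m : ℕ) :
    betaCoeff q a k z (j + m) * ((qPoch (k / a) q m * qPoch k q (2 * j + m)) /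
        (qPoch q q m * qPoch (a * q) q (2 * j + m))) =
      alphaCoeff q a z j * baileyKernel q a k z j m := by
  cases m with
  | zero => simpa only [add_zero, qPoch_zero, one_mul] using betaCoeff_mul_eq_baileyKernel_zero h j
  | succ m => exact betaCoeff_mul_eq_baileyKernel_succ h j m

lemma tendsto_zero_of_tendsto_mul_qPoch {V : ℕ → ℂ} (hq : ‖q‖ < 1)
    (h : Tendsto (fun j => V j * qPoch q q (j - 1)) atTop (𝓝 0)) : Tendsto V atTop (𝓝 0) := by
  have hbase := one_sub_mul_pow_ne_zero_of_norm_lt_one hq hq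
  have hlim := h.div ((tendsto_qPoch hq q).comp (tendsto_sub_atTop_nat 1))
    (qPochInf_ne_zero hq hbase)
  rw [zero_div] at hlim
  exact hlim.congr fun j => mul_div_cancel_right₀ _ (qPoch_ne_zero hbase _)

theorem seriesHasSum_beta (h : BaileyRegular q a k z) {rk : ℂ} (hrk : rk ^ 2 = k) {α β : ℕ → ℂ}
    (hpair : IsWPBaileyPair q a k α β) {A : ℂ}
    (hA : SeriesHasSum (fun n => qPoch z q n * qPoch q q (n - 1) /
        qPochs [q * a, q * a / z] q n * (q * a / z) ^ n * α n) A) :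
    SeriesHasSum (fun n => qPochs [q * rk, -q * rk, z] q n * qPoch q q (n - 1) /
        qPochs [rk, -rk, q * k, q * k / z] q n * (q * a / z) ^ n * β n)
      (lambert (q * k) q - lambert (q * a) q + lambert (q * a / z) q - lambert (q * k / z) q +
        A) := by
  set Λ := lambert (q * k) q - lambert (q * a) q + lambert (q * a / z) q - lambert (q * k / z) q
  set V : ℕ → ℂ := fun j => alphaCoeff q a z j * α j with hV
  set s : ℕ → ℂ := fun j => if j = 0 then 1 + Λ else qPoch q q (j - 1) with hs
  have hrow : ∀ j, HasSum (baileyKernel q a k z j) (s j)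
    | 0 => hasSum_baileyKernel_zero h
    | j + 1 => hasSum_baileyKernel_succ h j
  have hVq : SeriesHasSum (fun j => V j * qPoch q q (j - 1)) A := by
    convert hA using 2 with n
    simp only [hV, alphaCoeff, qPochs, List.map_cons, List.map_nil, List.prod_cons,
      List.prod_nil, mul_one]
    ring
  have hVs : SeriesHasSum (fun j => V j * s j) A := hVq.congr fun N => sum_congr rfl fun n hn => by
    simp only [hs, if_neg (Nat.one_le_iff_ne_zero.mp (mem_Icc.mp hn).1)]
  obtain ⟨C, hC⟩ := exists_norm_baileyKernel_le h
  have hdouble := seriesHasSum_sum_range_of_geometric (norm_nonneg _) h.norm_arg_lt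
    (tendsto_zero_of_tendsto_mul_qPoch h.norm_base_lt hVq.tendsto_zero) hC hrow hVs
  have hrow_zero : V 0 * (s 0 - baileyKernel q a k z 0 0) = Λ := by
    simp [hV, hs, alphaCoeff, baileyKernel, baileyScale, hpair.alpha_zero]
  rw [hrow_zero] at hdouble
  refine hdouble.congr fun N => sum_congr rfl fun n hn => ?_
  beta_reduce
  rw [betaCoeff_eq h hrk, hpair.beta_eq n (mem_Icc.mp hn).1, mul_sum]
  refine sum_congr rfl fun j hj => ?_
  obtain ⟨m, rfl⟩ := Nat.exists_eq_add_of_le (mem_range_succ_iff.mp hj)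
  rw [Nat.add_sub_cancel_left, show j + m + j = 2 * j + m by ring, ← mul_assoc,
    betaCoeff_mul_eq_baileyKernel h, hV]
  ring

end Bailey

section QuasiPeriodic

/-- `f` is holomorphic on `ℂ ∖ {0}` and quasi-periodic there under multiplication by `q`, with
multiplier `m`. -/
structure IsQuasiPeriodic (q : ℂ) (m f : ℂ → ℂ) : Prop where
  differentiableOn : DifferentiableOn ℂ f {0}ᶜ
  map_mul : ∀ x : ℂ, x ≠ 0 → f (q * x) = m x * f x

variable {q : ℂ} {m f g : ℂ → ℂ}

lemma zpow_mul_induction (hq0 : q ≠ 0) {P : ℂ → Prop} (hP : ∀ x, x ≠ 0 → (P (q * x) ↔ P x))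
    {y : ℂ} (hy : y ≠ 0) (hPy : P y) (n : ℤ) : P (q ^ n * y) := by
  have hstep (n : ℤ) : P (q ^ (n + 1) * y) ↔ P (q ^ n * y) := by
    rw [add_comm, zpow_one_add₀ hq0, mul_assoc, hP _ (by positivity)]
  induction n with
  | zero => simpa using hPy
  | succ n ih => exact (hstep n).mpr ih
  | pred n ih => exact (hstep _).mp (by simpa using ih)

lemma exists_norm_zpow_mul_mem_Icc (hq : ‖q‖ < 1) (hq0 : q ≠ 0) {x : ℂ} (hx : x ≠ 0) :
    ∃ n : ℤ, ‖q ^ n * x‖ ∈ Set.Icc 1 ‖q‖⁻¹ := by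
  have hq0' := norm_pos_iff.mpr hq0
  obtain ⟨n, hle, hlt⟩ := exists_mem_Ico_zpow (norm_pos_iff.mpr hx) ((one_lt_inv₀ hq0').mpr hq)
  rw [inv_zpow, inv_le_iff_one_le_mul₀' (by positivity)] at hle
  rw [inv_zpow, zpow_add_one₀ hq0'.ne', mul_inv, lt_inv_mul_iff₀ (by positivity)] at hlt
  exact ⟨n, by simpa only [norm_mul, norm_zpow] using ⟨hle, hlt.le⟩⟩

namespace IsQuasiPeriodic

lemma differentiableAt (hf : IsQuasiPeriodic q m f) {x : ℂ} (hx : x ≠ 0) :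
    DifferentiableAt ℂ f x :=
  hf.differentiableOn.differentiableAt (isOpen_compl_singleton.mem_nhds hx)

/-- Liouville's theorem on the compact torus `(ℂ ∖ {0}) / q^ℤ`. -/
theorem exists_forall_eq (hf : IsQuasiPeriodic q 1 f) (hq : ‖q‖ < 1) (hq0 : q ≠ 0) :
    ∃ c, ∀ x, x ≠ 0 → f x = c := by
  set K : Set ℂ := Metric.closedBall 0 ‖q‖⁻¹ \ Metric.ball 0 1
  have hK : IsCompact K := (isCompact_closedBall _ _).diff Metric.isOpen_ball
  have hK0 : ∀ x ∈ K, x ≠ 0 := by rintro x hx rfl; simp [K] at hx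
  have hrange : Set.range (f ∘ Complex.exp) ⊆ f '' K := by
    rintro _ ⟨w, rfl⟩
    obtain ⟨n, hn⟩ := exists_norm_zpow_mul_mem_Icc hq hq0 w.exp_ne_zero
    refine ⟨q ^ n * Complex.exp w, by simpa [K, and_comm] using hn, ?_⟩
    exact zpow_mul_induction (P := fun x => f x = f (Complex.exp w)) hq0
      (fun x hx => by rw [hf.map_mul x hx, Pi.one_apply, one_mul]) w.exp_ne_zero rfl n
  have hbdd : Bornology.IsBounded (Set.range (f ∘ Complex.exp)) :=
    (hK.image_of_continuousOn (hf.differentiableOn.continuousOn.mono hK0)).isBounded.subset hrange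
  have hdiff : Differentiable ℂ (f ∘ Complex.exp) := fun w =>
    (hf.differentiableAt w.exp_ne_zero).comp w Complex.differentiableAt_exp
  refine ⟨f 1, fun x hx => ?_⟩
  simpa [Complex.exp_log hx] using hdiff.apply_eq_apply_of_bounded hbdd (Complex.log x) 0

lemma mul_deriv_mul (hf : IsQuasiPeriodic q m f) (hq0 : q ≠ 0) (hm : DifferentiableOn ℂ m {0}ᶜ)
    {x : ℂ} (hx : x ≠ 0) : q * deriv f (q * x) = deriv m x * f x + m x * deriv f x := by
  have hx' : {0}ᶜ ∈ 𝓝 x := isOpen_compl_singleton.mem_nhds hx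
  have hleft : HasDerivAt (fun y => f (q * y)) (deriv f (q * x) * (q * 1)) x :=
    (hf.differentiableAt (mul_ne_zero hq0 hx)).hasDerivAt.comp x ((hasDerivAt_id x).const_mul q)
  have hright := (hm.differentiableAt hx').hasDerivAt.mul (hf.differentiableAt hx).hasDerivAt
  rw [mul_one, mul_comm] at hleft
  exact hleft.unique (hright.congr_of_eventuallyEq (eventually_of_mem hx' hf.map_mul))

lemma map_zpow_mul_eq_zero (hf : IsQuasiPeriodic q m f) (hq0 : q ≠ 0)
    (hm0 : ∀ x, x ≠ 0 → m x ≠ 0) {y : ℂ} (hy : y ≠ 0) (hfy : f y = 0) (n : ℤ) :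
    f (q ^ n * y) = 0 :=
  zpow_mul_induction (P := fun x => f x = 0) hq0
    (fun x hx => by rw [hf.map_mul x hx, mul_eq_zero_iff_left (hm0 x hx)]) hy hfy n

lemma deriv_zpow_mul_ne_zero (hf : IsQuasiPeriodic q m f) (hq0 : q ≠ 0)
    (hm : DifferentiableOn ℂ m {0}ᶜ) (hm0 : ∀ x, x ≠ 0 → m x ≠ 0) {y : ℂ} (hy : y ≠ 0)
    (hfy : f y = 0) (hf'y : deriv f y ≠ 0) (n : ℤ) : deriv f (q ^ n * y) ≠ 0 := by
  refine (zpow_mul_induction (P := fun x => f x = 0 ∧ deriv f x ≠ 0) hq0 (fun x hx => ?_) hy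
    ⟨hfy, hf'y⟩ n).2
  rw [hf.map_mul x hx, mul_eq_zero_iff_left (hm0 x hx)]
  refine and_congr_right fun hfx => not_congr ?_
  rw [← mul_eq_zero_iff_left hq0, hf.mul_deriv_mul hq0 hm hx, hfx, mul_zero, zero_add,
    mul_eq_zero_iff_left (hm0 x hx)]

end IsQuasiPeriodic

open Classical in
/-- The quotient `f / g`, extended to the simple zeros of `g` at which `f` vanishes. -/
noncomputable def extendedQuotient (f g : ℂ → ℂ) (x : ℂ) : ℂ :=
  if g x = 0 then deriv f x / deriv g x else f x / g x

lemma differentiableAt_extendedQuotient {U : Set ℂ} (hU : IsOpen U) (hf : DifferentiableOn ℂ f U)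
    (hg : DifferentiableOn ℂ g U) {y : ℂ} (hy : y ∈ U)
    (hzero : g y = 0 → f y = 0 ∧ deriv g y ≠ 0) :
    DifferentiableAt ℂ (extendedQuotient f g) y := by
  have hyU := hU.mem_nhds hy
  have hgy := hg.differentiableAt hyU
  by_cases h0 : g y = 0
  · obtain ⟨hfy, hg'y⟩ := hzero h0
    have hdslope : DifferentiableAt ℂ (fun x => dslope f y x / dslope g y x) y :=
      (((Complex.differentiableOn_dslope hyU).mpr hf).differentiableAt hyU).fun_div
        (((Complex.differentiableOn_dslope hyU).mpr hg).differentiableAt hyU)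
        (by rwa [dslope_same])
    refine hdslope.congr_of_eventuallyEq ?_
    have hne : ∀ᶠ x in 𝓝[≠] y, g x ≠ 0 := hgy.hasDerivAt.eventually_ne hg'y
    filter_upwards [eventually_nhdsWithin_iff.mp hne] with x hx
    rcases eq_or_ne x y with rfl | hxy
    · rw [extendedQuotient, if_pos h0, dslope_same, dslope_same]
    · rw [extendedQuotient, if_neg (hx hxy), dslope_of_ne _ hxy, dslope_of_ne _ hxy,
        slope_def_field, slope_def_field, hfy, h0, sub_zero, sub_zero,
        div_div_div_cancel_right₀ (sub_ne_zero.mpr hxy)]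
  · refine ((hf.differentiableAt hyU).fun_div hgy h0).congr_of_eventuallyEq ?_
    filter_upwards [hgy.continuousAt.eventually_ne h0] with x hx
    rw [extendedQuotient, if_neg hx]

theorem IsQuasiPeriodic.exists_forall_eq_mul (hf : IsQuasiPeriodic q m f)
    (hg : IsQuasiPeriodic q m g) (hq : ‖q‖ < 1) (hq0 : q ≠ 0) (hm : DifferentiableOn ℂ m {0}ᶜ)
    (hm0 : ∀ x, x ≠ 0 → m x ≠ 0)
    (hzero : ∀ x, x ≠ 0 → g x = 0 → f x = 0 ∧ deriv g x ≠ 0) :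
    ∃ c, ∀ x, x ≠ 0 → f x = c * g x := by
  have hquot : IsQuasiPeriodic q 1 (extendedQuotient f g) := by
    refine ⟨fun x hx => (differentiableAt_extendedQuotient isOpen_compl_singleton
      hf.differentiableOn hg.differentiableOn hx (hzero x hx)).differentiableWithinAt,
      fun x hx => ?_⟩
    simp only [extendedQuotient, Pi.one_apply, one_mul, hg.map_mul x hx, hf.map_mul x hx,
      mul_eq_zero_iff_left (hm0 x hx)]
    split_ifs with h0
    · rw [← mul_div_mul_left _ _ hq0, hf.mul_deriv_mul hq0 hm hx, hg.mul_deriv_mul hq0 hm hx, h0,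
        (hzero x hx h0).1, mul_zero, zero_add, zero_add, mul_div_mul_left _ _ (hm0 x hx)]
    · rw [mul_div_mul_left _ _ (hm0 x hx)]
  obtain ⟨c, hc⟩ := hquot.exists_forall_eq hq hq0
  refine ⟨c, fun x hx => ?_⟩
  by_cases h0 : g x = 0
  · rw [h0, (hzero x hx h0).1, mul_zero]
  · rw [← hc x hx, extendedQuotient, if_neg h0, div_mul_cancel₀ _ h0]

end QuasiPeriodic

section Theta

/-- The modified theta function `θ(x) = (x, q/x; q)_∞`. -/
noncomputable def theta (x q : ℂ) : ℂ := qPochInf x q * qPochInf (q / x) q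

/-- The negative `-x θ'(x) / θ(x)` of the logarithmic derivative of the theta function in the
variable `log x`; it is the multiplicative form of the Weierstrass zeta function. -/
noncomputable def zeta (x q : ℂ) : ℂ := -(x * deriv (fun y => theta y q) x) / theta x q

variable {q x : ℂ}

lemma multipliableLocallyUniformlyOn_one_sub_mul_pow (hq : ‖q‖ < 1) (R : ℝ) :
    MultipliableLocallyUniformlyOn (fun (i : ℕ) (x : ℂ) => 1 - x * q ^ i) (Metric.ball 0 R) := by
  have hbound : ∀ (i : ℕ), ∀ x ∈ Metric.ball (0 : ℂ) R, ‖-(x * q ^ i)‖ ≤ R * ‖q‖ ^ i := by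
    intro i x hx
    rw [norm_neg, norm_mul, norm_pow]
    exact mul_le_mul_of_nonneg_right (mem_ball_zero_iff.mp hx).le (by positivity)
  simpa only [← sub_eq_add_neg] using Summable.multipliableLocallyUniformlyOn_nat_one_add
    Metric.isOpen_ball ((summable_geometric_of_lt_one (norm_nonneg _) hq).mul_left R)
    (Eventually.of_forall hbound) (fun i => by fun_prop)

lemma differentiable_qPochInf (hq : ‖q‖ < 1) : Differentiable ℂ fun x => qPochInf x q := by
  intro x
  have hx : Metric.ball (0 : ℂ) (‖x‖ + 1) ∈ 𝓝 x := Metric.isOpen_ball.mem_nhds (by simp)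
  refine DifferentiableOn.differentiableAt ?_ hx
  exact (multipliableLocallyUniformlyOn_one_sub_mul_pow hq
    _).hasProdLocallyUniformlyOn.differentiableOn
    (.of_forall fun _ => by
      simpa [Finset.prod_fn] using DifferentiableOn.finsetProd (fun _ _ => by fun_prop))
    Metric.isOpen_ball

lemma mul_deriv_qPochInf (hq : ‖q‖ < 1) (h : ∀ i : ℕ, 1 - x * q ^ i ≠ 0) :
    x * deriv (fun x => qPochInf x q) x = -lambert x q * qPochInf x q := by
  rcases eq_or_ne x 0 with rfl | hx0
  · simp [lambert]
  have hne := qPochInf_ne_zero hq h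
  have hfactor : ∀ i : ℕ, x * logDeriv (fun x : ℂ => 1 - x * q ^ i) x =
      -(x * q ^ i / (1 - x * q ^ i)) := fun i => by
    rw [logDeriv_apply, deriv_const_sub, deriv_mul_const differentiableAt_id, deriv_id'']
    ring
  have hsum : Summable fun i : ℕ => logDeriv (fun x : ℂ => 1 - x * q ^ i) x := by
    rw [← summable_mul_left_iff hx0]
    simpa only [hfactor] using (hasSum_lambert hq h).summable.neg
  have hlogDeriv : x * logDeriv (fun x => qPochInf x q) x = -lambert x q := by
    unfold qPochInf
    rw [logDeriv_tprod_eq_tsum Metric.isOpen_ball (mem_ball_zero_iff.mpr (lt_add_one ‖x‖)) h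
      (fun i => by fun_prop) hsum (multipliableLocallyUniformlyOn_one_sub_mul_pow hq _) hne,
      ← tsum_mul_left]
    simp only [hfactor, tsum_neg, lambert]
  rw [← hlogDeriv, logDeriv_apply, mul_assoc, div_mul_cancel₀ _ hne]

lemma theta_eq_one_sub_mul (hq : ‖q‖ < 1) (x : ℂ) :
    theta x q = (1 - x) * (qPochInf (x * q) q * qPochInf (q / x) q) := by
  rw [theta, qPochInf_eq_one_sub_mul hq, mul_assoc]

lemma theta_one (hq : ‖q‖ < 1) : theta 1 q = 0 := by
  rw [theta_eq_one_sub_mul hq, sub_self, zero_mul]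

lemma theta_inv (hq : ‖q‖ < 1) (hx : x ≠ 0) : theta x⁻¹ q = -x⁻¹ * theta x q := by
  rw [theta_eq_one_sub_mul hq, theta_eq_one_sub_mul hq x, div_inv_eq_mul, mul_comm q x,
    ← div_eq_inv_mul]
  field_simp
  ring

lemma theta_mul_left (hq : ‖q‖ < 1) (hq0 : q ≠ 0) (hx : x ≠ 0) :
    theta (q * x) q = -x⁻¹ * theta x q := by
  rw [← theta_inv hq hx, theta, theta, div_inv_eq_mul, div_mul_cancel_left₀ hq0, mul_comm]

lemma theta_ne_zero (hq : ‖q‖ < 1) (h : ∀ m : ℤ, x ≠ q ^ m) : theta x q ≠ 0 :=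
  mul_ne_zero (qPochInf_ne_zero hq (one_sub_mul_pow_ne_zero_of_forall_ne_zpow h))
    (qPochInf_ne_zero hq (one_sub_div_mul_pow_ne_zero_of_forall_ne_zpow h))

lemma isQuasiPeriodic_theta (hq : ‖q‖ < 1) (hq0 : q ≠ 0) :
    IsQuasiPeriodic q (fun x => -x⁻¹) fun x => theta x q where
  differentiableOn := by
    have hP := differentiable_qPochInf hq
    exact hP.differentiableOn.mul (hP.comp_differentiableOn
      (DifferentiableOn.fun_div (differentiableOn_const q) differentiableOn_id fun _ hx => hx))
  map_mul _ hx := theta_mul_left hq hq0 hx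

lemma hasDerivAt_theta_one (hq : ‖q‖ < 1) :
    HasDerivAt (fun x => theta x q) (-qPochInf q q ^ 2) 1 := by
  have hP := differentiable_qPochInf hq
  have hcofactor : DifferentiableAt ℂ (fun x => qPochInf (x * q) q * qPochInf (q / x) q) 1 :=
    DifferentiableAt.mul ((hP (1 * q)).comp (1 : ℂ) (f := fun x => x * q) (by fun_prop))
      ((hP (q / 1)).comp (1 : ℂ) (f := fun x => q / x) (by fun_prop (disch := norm_num)))
  simp_rw [theta_eq_one_sub_mul hq]
  refine (((hasDerivAt_id (1 : ℂ)).const_sub 1).mul hcofactor.hasDerivAt).congr_deriv ?_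
  simp only [id, sub_self, zero_mul, add_zero, one_mul, div_one]
  ring

lemma zeta_eq_lambert_sub_lambert (hq : ‖q‖ < 1) (hx : x ≠ 0) (h : ∀ m : ℤ, x ≠ q ^ m) :
    zeta x q = lambert x q - lambert (q / x) q := by
  have hP := differentiable_qPochInf hq
  have hinv : HasDerivAt (fun x => q / x) (-(q / x) / x) x := by
    refine (HasDerivAt.fun_div (hasDerivAt_const x q) (hasDerivAt_id x) hx).congr_deriv ?_
    simp only [id]
    field_simp
    ring
  have htheta : HasDerivAt (fun x => theta x q) _ x :=
    (hP x).hasDerivAt.mul ((hP (q / x)).hasDerivAt.comp x hinv)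
  have hpos := mul_deriv_qPochInf hq (one_sub_mul_pow_ne_zero_of_forall_ne_zpow h)
  have hneg := mul_deriv_qPochInf hq (one_sub_div_mul_pow_ne_zero_of_forall_ne_zpow h)
  rw [zeta, div_eq_iff (theta_ne_zero hq h), htheta.deriv, theta]
  have hcancel : x * (-(q / x) / x) = -(q / x) := by field_simp
  linear_combination -qPochInf (q / x) q * hpos + qPochInf x q * hneg -
    qPochInf x q * deriv (fun x => qPochInf x q) (q / x) * hcancel

end Theta

section AdditionFormula

/-- The Wronskian of `f` and `g` for the derivation `x d/dx`, which commutes with `x ↦ q x`. -/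
noncomputable def eulerWronskian (f g : ℂ → ℂ) (x : ℂ) : ℂ :=
  x * (f x * deriv g x - deriv f x * g x)

variable {q a k z x : ℂ}

namespace IsQuasiPeriodic

variable {m n f g : ℂ → ℂ}

lemma mul (hf : IsQuasiPeriodic q m f) (hg : IsQuasiPeriodic q n g) :
    IsQuasiPeriodic q (fun x => m x * n x) fun x => f x * g x where
  differentiableOn := hf.differentiableOn.mul hg.differentiableOn
  map_mul x hx := by rw [hf.map_mul x hx, hg.map_mul x hx]; ring

lemma sub_const_mul (hf : IsQuasiPeriodic q m f) (hg : IsQuasiPeriodic q m g) (c : ℂ) :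
    IsQuasiPeriodic q m fun x => f x - c * g x where
  differentiableOn := hf.differentiableOn.sub (hg.differentiableOn.const_mul c)
  map_mul x hx := by rw [hf.map_mul x hx, hg.map_mul x hx]; ring

lemma comp_div_const (hf : IsQuasiPeriodic q m f) {c : ℂ} (hc : c ≠ 0) :
    IsQuasiPeriodic q (fun x => m (x / c)) fun x => f (x / c) where
  differentiableOn := hf.differentiableOn.comp (differentiableOn_id.div_const c)
    fun _ hx => div_ne_zero hx hc
  map_mul x hx := by rw [mul_div_assoc, hf.map_mul _ (div_ne_zero hx hc)]

lemma eulerWronskian {c : ℂ} (hf : IsQuasiPeriodic q m f)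
    (hg : IsQuasiPeriodic q (fun x => c * m x) g) (hq0 : q ≠ 0) (hm : DifferentiableOn ℂ m {0}ᶜ) :
    IsQuasiPeriodic q (fun x => m x * (c * m x)) (eulerWronskian f g) where
  differentiableOn := differentiableOn_id.mul
    ((hf.differentiableOn.mul (hg.differentiableOn.deriv isOpen_compl_singleton)).sub
      ((hf.differentiableOn.deriv isOpen_compl_singleton).mul hg.differentiableOn))
  map_mul x hx := by
    have hf' := hf.mul_deriv_mul hq0 hm hx
    have hg' := hg.mul_deriv_mul hq0 (hm.const_mul c) hx
    rw [deriv_const_mul_field'] at hg'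
    rw [WPBailey.eulerWronskian, WPBailey.eulerWronskian, hf.map_mul x hx, hg.map_mul x hx]
    linear_combination x * m x * f x * hg' - x * c * m x * g x * hf'

end IsQuasiPeriodic

lemma mul_deriv_theta (h : theta x q ≠ 0) :
    x * deriv (fun y => theta y q) x = -zeta x q * theta x q := by
  rw [zeta, neg_div, neg_neg, div_mul_cancel₀ _ h]

lemma exists_eq_zpow_of_theta_eq_zero (hq : ‖q‖ < 1) (h : theta x q = 0) :
    ∃ n : ℤ, x = q ^ n := by
  contrapose! h
  exact theta_ne_zero hq h

lemma differentiableOn_neg_inv : DifferentiableOn ℂ (fun x : ℂ => -x⁻¹) {0}ᶜ :=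
  differentiableOn_inv.neg.mono fun _ hx => hx

lemma zeta_mul_left (hq : ‖q‖ < 1) (hq0 : q ≠ 0) (hx : x ≠ 0) (h : theta x q ≠ 0) :
    zeta (q * x) q = zeta x q + 1 := by
  have hderiv := (isQuasiPeriodic_theta hq hq0).mul_deriv_mul hq0
    differentiableOn_neg_inv hx
  rw [deriv.fun_neg, deriv_inv] at hderiv
  rw [zeta, zeta, theta_mul_left hq hq0 hx]
  field_simp at hderiv ⊢
  linear_combination hderiv

lemma zeta_zpow_mul (hq : ‖q‖ < 1) (hq0 : q ≠ 0) (hx : x ≠ 0) (h : ∀ m : ℤ, x ≠ q ^ m) (n : ℤ) :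
    zeta (q ^ n * x) q = zeta x q + n := by
  have hstep (n : ℤ) : zeta (q ^ (n + 1) * x) q = zeta (q ^ n * x) q + 1 := by
    rw [add_comm, zpow_one_add₀ hq0, mul_assoc]
    refine zeta_mul_left hq hq0 (by positivity) (theta_ne_zero hq fun m hm => h (m - n) ?_)
    rw [zpow_sub₀ hq0, ← hm, mul_div_cancel_left₀ _ (by positivity)]
  induction n with
  | zero => simp
  | succ n ih => rw [hstep, ih]; push_cast; ring
  | pred n ih =>
    have := hstep (-n - 1)
    rw [sub_add_cancel, ih] at this
    push_cast at this ⊢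
    linear_combination -this

lemma hasDerivAt_theta_div (hq : ‖q‖ < 1) (hq0 : q ≠ 0) (hz : z ≠ 0) (hx : x ≠ 0) :
    HasDerivAt (fun y => theta (y / z) q) (deriv (fun y => theta y q) (x / z) / z) x := by
  have h := ((isQuasiPeriodic_theta hq hq0).differentiableAt (div_ne_zero hx hz)).hasDerivAt.comp x
    ((hasDerivAt_id x).div_const z)
  rwa [mul_one_div] at h

lemma eulerWronskian_theta (hq : ‖q‖ < 1) (hq0 : q ≠ 0) (hz : z ≠ 0) (hx : x ≠ 0)
    (hθ : theta x q ≠ 0) (hθz : theta (x / z) q ≠ 0) :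
    eulerWronskian (fun y => theta y q) (fun y => theta (y / z) q) x =
      (zeta x q - zeta (x / z) q) * (theta x q * theta (x / z) q) := by
  have h1 := mul_deriv_theta hθ
  have h2 := mul_deriv_theta hθz
  rw [eulerWronskian, (hasDerivAt_theta_div hq hq0 hz hx).deriv]
  linear_combination theta x q * h2 - theta (x / z) q * h1

lemma deriv_theta_mul_theta_div_one (hq : ‖q‖ < 1) (hq0 : q ≠ 0) (hz : z ≠ 0) :
    deriv (fun y => theta y q * theta (y / z) q) 1 = -qPochInf q q ^ 2 * theta (1 / z) q := by
  simpa only [theta_one hq, zero_mul, add_zero] using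
    ((hasDerivAt_theta_one hq).fun_mul (hasDerivAt_theta_div hq hq0 hz one_ne_zero)).deriv

lemma deriv_theta_mul_theta_div_self (hq : ‖q‖ < 1) (hq0 : q ≠ 0) (hz : z ≠ 0) :
    deriv (fun y => theta y q * theta (y / z) q) z = theta z q * (-qPochInf q q ^ 2 / z) := by
  have h := (((isQuasiPeriodic_theta hq hq0).differentiableAt hz).hasDerivAt.fun_mul
    (hasDerivAt_theta_div hq hq0 hz hz)).deriv
  rwa [div_self hz, theta_one hq, mul_zero, zero_add, (hasDerivAt_theta_one hq).deriv] at h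

lemma eulerWronskian_theta_one (hq : ‖q‖ < 1) :
    eulerWronskian (fun y => theta y q) (fun y => theta (y / z) q) 1 =
      qPochInf q q ^ 2 * theta (1 / z) q := by
  rw [eulerWronskian, theta_one hq, (hasDerivAt_theta_one hq).deriv]
  ring

lemma eulerWronskian_theta_self (hq : ‖q‖ < 1) (hq0 : q ≠ 0) (hz : z ≠ 0) :
    eulerWronskian (fun y => theta y q) (fun y => theta (y / z) q) z =
      -qPochInf q q ^ 2 * theta z q := by
  rw [eulerWronskian, (hasDerivAt_theta_div hq hq0 hz hz).deriv, div_self hz, theta_one hq,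
    (hasDerivAt_theta_one hq).deriv]
  field_simp
  ring

/-- The Wronskian of `θ(x)` and `θ(x/z)` minus the multiple of `θ(x/a) θ(ax/z)` that makes the
difference vanish at the zeros `1` and `z` of `θ(x) θ(x/z)`. -/
noncomputable def wronskianDefect (q a z x : ℂ) : ℂ :=
  eulerWronskian (fun y => theta y q) (fun y => theta (y / z) q) x -
    a / z * qPochInf q q ^ 2 * theta z q / (theta a q * theta (a / z) q) *
      (theta (x / a) q * theta (x / (z / a)) q)

lemma wronskianDefect_one (hq : ‖q‖ < 1) (ha : a ≠ 0) (hz : z ≠ 0)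
    (haq : ∀ m : ℤ, a ≠ q ^ m) (haz : ∀ m : ℤ, a / z ≠ q ^ m) : wronskianDefect q a z 1 = 0 := by
  have hθa := theta_ne_zero hq haq
  have hθaz := theta_ne_zero hq haz
  rw [wronskianDefect, eulerWronskian_theta_one hq, one_div_div, one_div, one_div,
    theta_inv hq hz, theta_inv hq ha]
  field_simp
  ring

lemma wronskianDefect_self (hq : ‖q‖ < 1) (hq0 : q ≠ 0) (ha : a ≠ 0) (hz : z ≠ 0)
    (haq : ∀ m : ℤ, a ≠ q ^ m) (haz : ∀ m : ℤ, a / z ≠ q ^ m) : wronskianDefect q a z z = 0 := by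
  have hθa := theta_ne_zero hq haq
  have hθaz := theta_ne_zero hq haz
  rw [wronskianDefect, eulerWronskian_theta_self hq hq0 hz, div_div_cancel₀ hz, ← inv_div a z,
    theta_inv hq (div_ne_zero ha hz)]
  field_simp
  ring

lemma isQuasiPeriodic_theta_div (hq : ‖q‖ < 1) (hq0 : q ≠ 0) (hz : z ≠ 0) :
    IsQuasiPeriodic q (fun x => z * -x⁻¹) fun x => theta (x / z) q := by
  convert (isQuasiPeriodic_theta hq hq0).comp_div_const hz using 2 with x
  rw [inv_div]
  ring

lemma isQuasiPeriodic_wronskianDefect (hq : ‖q‖ < 1) (hq0 : q ≠ 0) (ha : a ≠ 0) (hz : z ≠ 0) :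
    IsQuasiPeriodic q (fun x => -x⁻¹ * (z * -x⁻¹)) (wronskianDefect q a z) := by
  have hprod : IsQuasiPeriodic q (fun x => -x⁻¹ * (z * -x⁻¹))
      fun x => theta (x / a) q * theta (x / (z / a)) q := by
    convert (isQuasiPeriodic_theta_div hq hq0 ha).mul
      (isQuasiPeriodic_theta_div hq hq0 (div_ne_zero hz ha)) using 2 with x
    field_simp
  exact ((isQuasiPeriodic_theta hq hq0).eulerWronskian (isQuasiPeriodic_theta_div hq hq0 hz) hq0
    differentiableOn_neg_inv).sub_const_mul hprod _

lemma exists_wronskianDefect_eq_mul (hq : ‖q‖ < 1) (hq0 : q ≠ 0) (ha : a ≠ 0)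
    (hz : z ≠ 0) (haq : ∀ m : ℤ, a ≠ q ^ m) (haz : ∀ m : ℤ, a / z ≠ q ^ m)
    (hzq : ∀ m : ℤ, z ≠ q ^ m) :
    ∃ C, ∀ x, x ≠ 0 → wronskianDefect q a z x = C * (theta x q * theta (x / z) q) := by
  have hθz := theta_ne_zero hq hzq
  have hqq : qPochInf q q ≠ 0 :=
    qPochInf_ne_zero hq (one_sub_mul_pow_ne_zero_of_norm_lt_one hq hq)
  have hm : DifferentiableOn ℂ (fun x : ℂ => -x⁻¹ * (z * -x⁻¹)) {0}ᶜ :=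
    differentiableOn_neg_inv.mul (differentiableOn_neg_inv.const_mul z)
  have hm0 : ∀ x : ℂ, x ≠ 0 → -x⁻¹ * (z * -x⁻¹) ≠ 0 := fun x hx => by simp [hx, hz]
  have hleft := isQuasiPeriodic_wronskianDefect hq hq0 ha hz
  have hright := (isQuasiPeriodic_theta hq hq0).mul (isQuasiPeriodic_theta_div hq hq0 hz)
  refine hleft.exists_forall_eq_mul hright hq hq0 hm hm0 fun x hx h0 => ?_
  rcases mul_eq_zero.mp h0 with h0 | h0
  · obtain ⟨n, rfl⟩ := exists_eq_zpow_of_theta_eq_zero hq h0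
    rw [← mul_one (q ^ n)]
    refine ⟨hleft.map_zpow_mul_eq_zero hq0 hm0 one_ne_zero
      (wronskianDefect_one hq ha hz haq haz) n,
      hright.deriv_zpow_mul_ne_zero hq0 hm hm0 one_ne_zero (by rw [theta_one hq, zero_mul]) ?_ n⟩
    rw [deriv_theta_mul_theta_div_one hq hq0 hz, one_div, theta_inv hq hz]
    simp [hqq, hz, hθz]
  · obtain ⟨n, hn⟩ := exists_eq_zpow_of_theta_eq_zero hq h0
    obtain rfl := (div_eq_iff hz).mp hn
    refine ⟨hleft.map_zpow_mul_eq_zero hq0 hm0 hz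
      (wronskianDefect_self hq hq0 ha hz haq haz) n,
      hright.deriv_zpow_mul_ne_zero hq0 hm hm0 hz (by simp [hz, theta_one hq]) ?_ n⟩
    rw [deriv_theta_mul_theta_div_self hq hq0 hz]
    simp [hqq, hz, hθz]

theorem zeta_addition (hq : ‖q‖ < 1) (hq0 : q ≠ 0) (ha : a ≠ 0) (hk : k ≠ 0) (hz : z ≠ 0)
    (haq : ∀ m : ℤ, a ≠ q ^ m) (hkq : ∀ m : ℤ, k ≠ q ^ m)
    (haz : ∀ m : ℤ, a / z ≠ q ^ m) (hkz : ∀ m : ℤ, k / z ≠ q ^ m) :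
    zeta k q - zeta (k / z) q + zeta (a / z) q - zeta a q =
      a / z * qPochInf q q ^ 2 * (theta z q * theta (k / a) q * theta (a * k / z) q) /
        (theta k q * theta (k / z) q * theta a q * theta (a / z) q) := by
  have hθa := theta_ne_zero hq haq
  have hθaz := theta_ne_zero hq haz
  have hθk := theta_ne_zero hq hkq
  have hθkz := theta_ne_zero hq hkz
  by_cases hzq : ∃ n : ℤ, z = q ^ n
  · obtain ⟨n, rfl⟩ := hzq
    have hθz : theta (q ^ n) q = 0 := by
      simpa using (isQuasiPeriodic_theta hq hq0).map_zpow_mul_eq_zero hq0 (by simp) one_ne_zero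
        (theta_one hq) n
    have hshift {x : ℂ} (hx : x ≠ 0) (hxz : ∀ m : ℤ, x / q ^ n ≠ q ^ m) :
        zeta x q = zeta (x / q ^ n) q + n := by
      simpa [mul_div_cancel₀ _ hz] using zeta_zpow_mul hq hq0 (div_ne_zero hx hz) hxz n
    rw [hshift hk hkz, hshift ha haz, hθz]
    ring
  · obtain ⟨C, hC⟩ := exists_wronskianDefect_eq_mul hq hq0 ha hz haq haz
      (not_exists.mp hzq)
    have hCk := hC k hk
    have hCa := hC a ha
    rw [wronskianDefect, eulerWronskian_theta hq hq0 hz hk hθk hθkz] at hCk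
    rw [wronskianDefect, eulerWronskian_theta hq hq0 hz ha hθa hθaz, div_self ha, theta_one hq,
      zero_mul, mul_zero, sub_zero] at hCa
    obtain rfl := mul_right_cancel₀ (mul_ne_zero hθa hθaz) hCa
    rw [show k / (z / a) = a * k / z by field_simp] at hCk
    have hden := div_mul_cancel₀ (a / z * qPochInf q q ^ 2 * theta z q) (mul_ne_zero hθa hθaz)
    rw [eq_div_iff (by simp [*])]
    linear_combination theta a q * theta (a / z) q * hCk +
      theta (k / a) q * theta (a * k / z) q * hden

end AdditionFormula

section LambertCombination

variable {q a k z : ℂ}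

lemma div_ne_zpow_of_ne_mul_zpow {x : ℂ} (hx : x ≠ 0) (h : ∀ m : ℤ, z ≠ x * q ^ m) (m : ℤ) :
    x / z ≠ q ^ m := fun h1 => h (-m) <| by
  rw [zpow_neg, ← h1, inv_div, mul_div_cancel₀ _ hx]

lemma qPochsInf_div_qPochsInf (hq : ‖q‖ < 1) (ha : a ≠ 0) (hk : k ≠ 0) (hz : z ≠ 0) :
    z / k * (qPochsInf [z, q / z, k / a, q * a / k, a * k / z, q * z / (a * k), q, q] q /
        qPochsInf [z / k, q * k / z, z / a, q * a / z, a, q / a, k, q / k] q) =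
      a / z * qPochInf q q ^ 2 * (theta z q * theta (k / a) q * theta (a * k / z) q) /
        (theta k q * theta (k / z) q * theta a q * theta (a / z) q) := by
  have hnum : qPochsInf [z, q / z, k / a, q * a / k, a * k / z, q * z / (a * k), q, q] q =
      qPochInf q q ^ 2 * (theta z q * theta (k / a) q * theta (a * k / z) q) := by
    simp only [qPochsInf, theta, List.map_cons, List.map_nil, List.prod_cons, List.prod_nil,
      div_div_eq_mul_div]
    ring
  have hden : qPochsInf [z / k, q * k / z, z / a, q * a / z, a, q / a, k, q / k] q =
      theta (k / z)⁻¹ q * theta (a / z)⁻¹ q * theta a q * theta k q := by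
    simp only [qPochsInf, theta, List.map_cons, List.map_nil, List.prod_cons, List.prod_nil,
      inv_div, div_div_eq_mul_div]
    ring
  rw [hnum, hden, theta_inv hq (div_ne_zero hk hz), theta_inv hq (div_ne_zero ha hz)]
  field_simp

lemma div_one_sub_combination {w : ℂ} (h1a : 1 - a ≠ 0) (h1k : 1 - k ≠ 0) (h1aw : 1 - a * w ≠ 0)
    (h1kw : 1 - k * w ≠ 0) :
    a / (1 - a) - k / (1 - k) + k * w / (1 - k * w) - a * w / (1 - a * w) =
      (a - k) * (1 - w) * (1 - a * k * w) /
        ((1 - a) * (1 - k) * (1 - a * w) * (1 - k * w)) := by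
  have hak : a / (1 - a) - k / (1 - k) = (a - k) / ((1 - a) * (1 - k)) := by
    rw [div_sub_div _ _ h1a h1k]
    ring
  have hakw : k * w / (1 - k * w) - a * w / (1 - a * w) =
      -(w * (a - k)) / ((1 - a * w) * (1 - k * w)) := by
    rw [div_sub_div _ _ h1kw h1aw]
    ring
  rw [add_sub_assoc, hak, hakw, div_add_div _ _ (by simp [*]) (by simp [*])]
  ring

lemma lambert_mul_left_sub_lambert_div (hq : ‖q‖ < 1) {x : ℂ} (hx : x ≠ 0)
    (h : ∀ m : ℤ, x ≠ q ^ m) :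
    lambert (q * x) q - lambert (q / x) q = zeta x q - x / (1 - x) := by
  rw [zeta_eq_lambert_sub_lambert hq hx h,
    lambert_eq_add_lambert_mul hq (one_sub_mul_pow_ne_zero_of_forall_ne_zpow h), mul_comm q x]
  ring

lemma theta_zero_right (x : ℂ) : theta x 0 = 1 - x := by
  rw [theta_eq_one_sub_mul (by simp)]
  simp [qPochInf]

theorem lambert_combination (hq : ‖q‖ < 1) (ha : a ≠ 0) (hk : k ≠ 0) (hz : z ≠ 0)
    (haq : ∀ m : ℤ, a ≠ q ^ m) (hkq : ∀ m : ℤ, k ≠ q ^ m)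
    (haz : ∀ m : ℤ, a / z ≠ q ^ m) (hkz : ∀ m : ℤ, k / z ≠ q ^ m) :
    lambert (q * k) q - lambert (q * a) q + lambert (q * a / z) q - lambert (q * k / z) q -
      (lambert (q / k) q - lambert (q / a) q + lambert (q * z / a) q - lambert (q * z / k) q) =
      (a - k) * (1 - 1 / z) * (1 - a * k / z) /
          ((1 - a) * (1 - k) * (1 - a / z) * (1 - k / z)) +
        z / k * (qPochsInf [z, q / z, k / a, q * a / k, a * k / z, q * z / (a * k), q, q] q /
          qPochsInf [z / k, q * k / z, z / a, q * a / z, a, q / a, k, q / k] q) := by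
  have h1 {x : ℂ} (h : ∀ m : ℤ, x ≠ q ^ m) : 1 - x ≠ 0 :=
    sub_ne_zero.mpr (by simpa using (h 0).symm)
  have hrat := div_one_sub_combination (w := z⁻¹) (h1 haq) (h1 hkq) (h1 haz) (h1 hkz)
  simp only [← div_eq_mul_inv] at hrat
  rcases eq_or_ne q 0 with rfl | hq0
  · have hsum : (a - k) * (1 - 1 / z) + a / z * ((1 - z) * (1 - k / a)) = 0 := by
      field_simp
      ring
    rw [qPochsInf_div_qPochsInf hq ha hk hz]
    simp only [theta_zero_right]
    simp only [lambert, qPochInf, zero_mul, zero_div, sub_zero, sub_self, tsum_zero, tprod_one]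
    linear_combination -(1 - a * k / z) / ((1 - a) * (1 - k) * (1 - a / z) * (1 - k / z)) * hsum
  · have hLk := lambert_mul_left_sub_lambert_div hq hk hkq
    have hLa := lambert_mul_left_sub_lambert_div hq ha haq
    have hLkz := lambert_mul_left_sub_lambert_div hq (div_ne_zero hk hz) hkz
    have hLaz := lambert_mul_left_sub_lambert_div hq (div_ne_zero ha hz) haz
    rw [div_div_eq_mul_div, ← mul_div_assoc] at hLkz hLaz
    rw [qPochsInf_div_qPochsInf hq ha hk hz, ← zeta_addition hq hq0 ha hk hz haq hkq haz hkz,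
      one_div, ← hrat]
    linear_combination hLk - hLa + hLaz - hLkz

end LambertCombination

section Theorem

variable {q a k z : ℂ}

lemma baileyRegular_of_forall_ne_zpow (hq : ‖q‖ < 1) (ha : a ≠ 0) (hz : z ≠ 0)
    (haq : ∀ m : ℤ, a ≠ q ^ m) (hkq : ∀ m : ℤ, k ≠ q ^ m) (hkz : ∀ m : ℤ, k / z ≠ q ^ m)
    (hconv : ‖q * a‖ < ‖z‖) : BaileyRegular q a k z where
  norm_base_lt := hq
  norm_arg_lt := by rwa [norm_div, div_lt_one (norm_pos_iff.mpr hz)]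
  a_ne_zero := ha
  z_ne_zero := hz
  one_sub_k := one_sub_mul_pow_ne_zero_of_forall_ne_zpow hkq
  one_sub_a := one_sub_mul_pow_ne_zero_of_forall_ne_zpow haq
  one_sub_div i := by
    rw [show q * k / z * q ^ i = k / z * q ^ (i + 1) by ring]
    exact one_sub_mul_pow_ne_zero_of_forall_ne_zpow hkz _

theorem seriesHasSum_beta_inv (hq : ‖q‖ < 1) (ha : a ≠ 0) (hz : z ≠ 0)
    (haq : ∀ m : ℤ, a ≠ q ^ m) (hkq : ∀ m : ℤ, k ≠ q ^ m) (hkz : ∀ m : ℤ, k / z ≠ q ^ m)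
    (hconv : ‖q * z‖ < ‖a‖) {rk : ℂ} (hrk : rk ^ 2 = 1 / k) {α β : ℕ → ℂ}
    (hpair : IsWPBaileyPair q (1 / a) (1 / k) α β) {A : ℂ}
    (hA : SeriesHasSum (fun n => qPoch (1 / z) q n * qPoch q q (n - 1) /
        qPochs [q / a, q * z / a] q n * (q * z / a) ^ n * α n) A) :
    SeriesHasSum (fun n => qPochs [q * rk, -q * rk, 1 / z] q n * qPoch q q (n - 1) /
        qPochs [rk, -rk, q / k, q * z / k] q n * (q * z / a) ^ n * β n)
      (lambert (q / k) q - lambert (q / a) q + lambert (q * z / a) q - lambert (q * z / k) q +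
        A) := by
  have hdiv (x : ℂ) : q / x / (1 / z) = q * z / x := by field_simp
  have h : BaileyRegular q (1 / a) (1 / k) (1 / z) := by
    refine baileyRegular_of_forall_ne_zpow hq (one_div_ne_zero ha) (one_div_ne_zero hz) ?_ ?_ ?_ ?_
    · simpa only [one_div] using inv_ne_zpow haq
    · simpa only [one_div] using inv_ne_zpow hkq
    · simpa only [one_div, inv_div_inv, inv_div] using inv_ne_zpow hkz
    · rwa [mul_one_div, norm_div, norm_div, norm_one, div_lt_div_iff₀ (norm_pos_iff.mpr ha)
        (norm_pos_iff.mpr hz), one_mul, ← norm_mul]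
  have hβ := seriesHasSum_beta (A := A) h hrk hpair (by simpa only [mul_one_div, hdiv] using hA)
  simpa only [mul_one_div, hdiv] using hβ

end Theorem

end WPBailey

theorem theorem1
    (q a k z : ℂ) (α β : ℂ → ℂ → ℕ → ℂ)
    -- `rk` and `rk'` are any square roots of `k` and of `1/k`
    (rk rk' : ℂ) (hrk : rk ^ 2 = k) (hrk' : rk' ^ 2 = 1 / k)
    (hq : ‖q‖ < 1) (ha : a ≠ 0) (hk : k ≠ 0) (hz : z ≠ 0)
    -- the family is a WP-Bailey pair at the two pairs of parameters that occur
    (hpair : WPBailey.IsWPBaileyPair q a k (α a k) (β a k))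
    (hpair' : WPBailey.IsWPBaileyPair q (1 / a) (1 / k) (α (1 / a) (1 / k)) (β (1 / a) (1 / k)))
    -- no denominator vanishes
    (haq : ∀ m : ℤ, a ≠ q ^ m) (hkq : ∀ m : ℤ, k ≠ q ^ m)
    (hza : ∀ m : ℤ, z ≠ a * q ^ m) (hzk : ∀ m : ℤ, z ≠ k * q ^ m)
    -- convergence conditions: `|qa| < |z| < |a/q|`, and the two `α`-series converge
    (hconv : ‖q * a‖ < ‖z‖) (hconv' : ‖q * z‖ < ‖a‖)
    (A A' : ℂ)
    (hA : WPBailey.SeriesHasSum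
      (fun n => WPBailey.qPoch z q n * WPBailey.qPoch q q (n - 1) /
        WPBailey.qPochs [q * a, q * a / z] q n * (q * a / z) ^ n * α a k n) A)
    (hA' : WPBailey.SeriesHasSum
      (fun n => WPBailey.qPoch (1 / z) q n * WPBailey.qPoch q q (n - 1) /
        WPBailey.qPochs [q / a, q * z / a] q n * (q * z / a) ^ n * α (1 / a) (1 / k) n) A') :
    ∃ B B' : ℂ,
      WPBailey.SeriesHasSum
        (fun n => WPBailey.qPochs [q * rk, -q * rk, z] q n * WPBailey.qPoch q q (n - 1) /
          WPBailey.qPochs [rk, -rk, q * k, q * k / z] q n * (q * a / z) ^ n * β a k n) B ∧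
      WPBailey.SeriesHasSum
        (fun n => WPBailey.qPochs [q * rk', -q * rk', 1 / z] q n * WPBailey.qPoch q q (n - 1) /
          WPBailey.qPochs [rk', -rk', q / k, q * z / k] q n * (q * z / a) ^ n *
            β (1 / a) (1 / k) n) B' ∧
      B - B' - A + A' =
        (a - k) * (1 - 1 / z) * (1 - a * k / z) /
          ((1 - a) * (1 - k) * (1 - a / z) * (1 - k / z)) +
        z / k *
          (WPBailey.qPochsInf
              [z, q / z, k / a, q * a / k, a * k / z, q * z / (a * k), q, q] q /
            WPBailey.qPochsInf
              [z / k, q * k / z, z / a, q * a / z, a, q / a, k, q / k] q) := by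
  have haz := WPBailey.div_ne_zpow_of_ne_mul_zpow ha hza
  have hkz := WPBailey.div_ne_zpow_of_ne_mul_zpow hk hzk
  have hB := WPBailey.seriesHasSum_beta
    (WPBailey.baileyRegular_of_forall_ne_zpow hq ha hz haq hkq hkz hconv) hrk hpair hA
  have hB' := WPBailey.seriesHasSum_beta_inv hq ha hz haq hkq hkz hconv' hrk' hpair' hA'
  refine ⟨_, _, hB, hB', ?_⟩
  rw [← WPBailey.lambert_combination hq ha hk hz haq hkq haz hkz]
  ring
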